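/- \textbf{Setting.} For $x\in\mathbb R^2$ and $u\in\mathbb R_+^2=(0,\infty)^2$ let $B(x,u)=[x_1-\frac{u_1}2,x_1+\frac{u_1}2]\times[x_2-\frac{u_2}2,x_2+\frac{u_2}2]$. Let $\gamma_1,\gamma_2\in(1,2)$ and let $f_1,f_2\ge 0$ be measurable functions on $(0,\infty)$ with $f_i(u)\,u^{\gamma_i+1}\to 1$ as $u\to\infty$ for $i=1,2$, such that $F(\mathrm du)=f_1(u_1)f_2(u_2)\,\mathrm du_1\,\mathrm du_2$ is a probability measure on $\mathbb R_+^2$. For $\rho>0$ let $F_\rho$ be the image of $F$ under $u\mapsto\rho u$, let $\lambda_\rho>0$, and let $N_\rho$ be a Poisson random measure on $\mathbb R^2\times\mathbb R_+^2$ with intensity measure $\lambda_\rho\,\mathrm dx\,F_\rho(\mathrm du)$. For a finite signed measure $\mu$ on $\mathbb R^2$ put $$J_\rho(\mu)=\int_{\mathbb R^2\times\mathbb R_+^2}\mu(B(x,u))\,N_\rho(\mathrm dx,\mathrm du),\qquad \widetilde J_\rho(\mu)=J_\rho(\mu)-\mathbb E J_\rho(\mu).$$ Let $\mathcal M^{\gamma_1,\gamma_2}$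 be the set of finite signed measures $\mu$ on $\mathbb R^2$ for which there are constants $C>0$ and $\alpha_i$ with $\gamma_i<\alpha_i\le 2$ $(i=1,2)$ such that for all $u\in\mathbb R_+^2$ $$\int_{\mathbb R^2}\mu(B(x,u))^2\,\mathrm dx\le C\min(u_1,u_1^{\alpha_1})\min(u_2,u_2^{\alpha_2}).$$ Let $N_I$ be a Poisson random measure on $\mathbb R^2\times\mathbb R_+^2$ with intensity measure $n_I(\mathrm dx,\mathrm du)=\mathrm dx\,u_1^{-\gamma_1-1}u_2^{-\gamma_2-1}\,\mathrm du_1\,\mathrm du_2$. The compensated integral $\int f\,\mathrm d\widetilde N_I$ is a random variable which, for every sequence of measurable $n_I$-integrable functions $g_k\to f$ (pointwise) with $|g_k|\le|f|$, is the limit in probability of $\int g_k\,\mathrm dN_I-\int g_k\,\mathrm dn_I$; when it exists it is almost surely unique. \textbf{Theorem} (intermediate intensity regime). Suppose that $\lambda_\rho\to\infty$ and $\lambda_\rho\rho^{\gamma_1+\gamma_2}\to 1$ as $\rho\downarrow 0$. Then: (i) for every $\rho>0$ and every finite signed measure $\mu$, the integral $J_\rho(\mu)$ exists almost surely and has finite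 expectation; (ii) for every $\mu\in\mathcal M^{\gamma_1,\gamma_2}$ the compensated Poisson integral $$J_I(\mu)=\int_{\mathbb R^2\times\mathbb R_+^2}\mu(B(x,u))\,\widetilde N_I(\mathrm dx,\mathrm du)$$ exists, and $J_I$ is linear: $J_I(a\mu+b\nu)=aJ_I(\mu)+bJ_I(\nu)$ almost surely for all $\mu,\nu\in\mathcal M^{\gamma_1,\gamma_2}$ and $a,b\in\mathbb R$; (iii) as $\rho\downarrow 0$, the finite-dimensional distributions of $(\widetilde J_\rho(\mu))_{\mu\in\mathcal M^{\gamma_1,\gamma_2}}$ converge to those of $(J_I(\mu))_{\mu\in\mathcal M^{\gamma_1,\gamma_2}}$, i.e. $(\widetilde J_\rho(\mu_1),\dots,\widetilde J_\rho(\mu_m))\to(J_I(\mu_1),\dots,J_I(\mu_m))$ in distribution for all $m$ and all $\mu_1,\dots,\mu_m\in\mathcal M^{\gamma_1,\gamma_2}$. -/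

import Mathlib

open MeasureTheory ProbabilityTheory Filter Topology Asymptotics
open scoped ENNReal

namespace RandomBoxes

noncomputable section

/-- The closed box in the plane with centre `x` and edge lengths `u.1`, `u.2`. -/
def box (x u : ℝ × ℝ) : Set (ℝ × ℝ) :=
  Set.Icc (x.1 - u.1 / 2) (x.1 + u.1 / 2) ×ˢ Set.Icc (x.2 - u.2 / 2) (x.2 + u.2 / 2)

/-- The open quadrant of (positive) edge lengths. -/
def quadrant : Set (ℝ × ℝ) := Set.Ioi 0 ×ˢ Set.Ioi 0

/-- The function `(x, u) ↦ μ (B(x, u))`. Signed measures in Mathlib are real valued,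
so they all have finite total variation. -/
def boxMass (μ : SignedMeasure (ℝ × ℝ)) (p : (ℝ × ℝ) × (ℝ × ℝ)) : ℝ := μ (box p.1 p.2)

/-- The measure `f₁(u₁) f₂(u₂) du₁ du₂` on the positive edge lengths. -/
def sizeMeasure (f₁ f₂ : ℝ → ℝ) : Measure (ℝ × ℝ) :=
  (volume.restrict quadrant).withDensity fun u ↦ ENNReal.ofReal (f₁ u.1 * f₂ u.2)

instance (f₁ f₂ : ℝ → ℝ) : SFinite (sizeMeasure f₁ f₂) := by
  unfold sizeMeasure; infer_instance

/-- The intensity measure `l dx F_ρ(du)`, where `F_ρ` is the image of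
`F(du) = f₁(u₁) f₂(u₂) du` under `u ↦ ρ u`. -/
def scaledIntensity (f₁ f₂ : ℝ → ℝ) (l ρ : ℝ) : Measure ((ℝ × ℝ) × (ℝ × ℝ)) :=
  ENNReal.ofReal l •
    (volume : Measure (ℝ × ℝ)).prod ((sizeMeasure f₁ f₂).map fun u ↦ ρ • u)

/-- The intensity measure `dx u₁ ^ (-γ₁-1) u₂ ^ (-γ₂-1) du₁ du₂` with `u₁, u₂ > 0`. -/
def limitIntensity (γ₁ γ₂ : ℝ) : Measure ((ℝ × ℝ) × (ℝ × ℝ)) :=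
  (volume : Measure (ℝ × ℝ)).prod
    (sizeMeasure (fun u ↦ 1 / u ^ (γ₁ + 1)) (fun u ↦ 1 / u ^ (γ₂ + 1)))

/-- The space of signed measures `μ` for which there are `C > 0` and `γᵢ < αᵢ ≤ 2` with
`∫ μ(B(x,u))² dx ≤ C min(u₁, u₁^α₁) min(u₂, u₂^α₂)` for all `u₁, u₂ > 0`. -/
def testMeasures (γ₁ γ₂ : ℝ) : Set (SignedMeasure (ℝ × ℝ)) :=
  {μ | ∃ C α₁ α₂ : ℝ, 0 < C ∧ γ₁ < α₁ ∧ α₁ ≤ 2 ∧ γ₂ < α₂ ∧ α₂ ≤ 2 ∧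
    ∀ u ∈ quadrant, ∫ x, boxMass μ (x, u) ^ 2 ≤
      C * min u.1 (u.1 ^ α₁) * min u.2 (u.2 ^ α₂)}

section Poisson

variable {Ω E : Type*} [MeasurableSpace Ω] [MeasurableSpace E]

/-- `N` is a Poisson random measure on `E` with (σ-finite) intensity measure `n`, defined on the
probability space `(Ω, P)`: it is a random measure, `N(A)` has the Poisson distribution with
mean `n(A)` when `n(A) < ∞`, and `N` is independent over disjoint sets. -/
structure IsPoissonRandomMeasure (P : Measure Ω) (N : Ω → Measure E) (n : Measure E) : Prop where
  measurable : Measurable N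
  hasLaw : ∀ A : Set E, MeasurableSet A → n A ≠ ∞ →
    HasLaw (fun ω ↦ N ω A)
      ((poissonMeasure (n A).toNNReal).map (Nat.cast : ℕ → ℝ≥0∞)) P
  indep : ∀ (m : ℕ) (A : Fin m → Set E), (∀ i, MeasurableSet (A i)) →
    Pairwise (Function.onFun Disjoint A) → iIndepFun (fun i ω ↦ N ω (A i)) P

/-- `X` is (a version of) the compensated integral `∫ f d(N - n)`: the limit in probability of
`∫ gₖ dN - ∫ gₖ dn` for every sequence of measurable, `n`-integrable functions `gₖ` with
`|gₖ| ≤ |f|` and `gₖ → f` pointwise. -/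
structure IsCompensatedIntegral (P : Measure Ω) (N : Ω → Measure E) (n : Measure E)
    (f : E → ℝ) (X : Ω → ℝ) : Prop where
  measurable : Measurable X
  tendsto : ∀ g : ℕ → E → ℝ, (∀ k, Measurable (g k)) → (∀ k, Integrable (g k) n) →
    (∀ k e, |g k e| ≤ |f e|) → (∀ e, Tendsto (fun k ↦ g k e) atTop (𝓝 (f e))) →
    TendstoInMeasure P (fun k ω ↦ ∫ e, g k e ∂(N ω) - ∫ e, g k e ∂n) atTop X

open Classical in
/-- The compensated integral `∫ f d(N - n)` (unique up to null sets when it exists; `0` when it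
does not exist). -/
def compensatedIntegral (P : Measure Ω) (N : Ω → Measure E) (n : Measure E)
    (f : E → ℝ) : Ω → ℝ :=
  if h : ∃ X, IsCompensatedIntegral P N n f X then h.choose else 0

end Poisson

section Fields

variable {Ω : Type*} [MeasurableSpace Ω]

/-- The field `J(μ) = ∫ μ(B(x,u)) N(dx, du)`. -/
def field (N : Ω → Measure ((ℝ × ℝ) × (ℝ × ℝ))) (μ : SignedMeasure (ℝ × ℝ)) (ω : Ω) : ℝ :=
  ∫ p, boxMass μ p ∂(N ω)

/-- The centred field `J(μ) - 𝔼 J(μ)`. -/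
def centredField (P : Measure Ω) (N : Ω → Measure ((ℝ × ℝ) × (ℝ × ℝ)))
    (μ : SignedMeasure (ℝ × ℝ)) (ω : Ω) : ℝ :=
  field N μ ω - ∫ ω', field N μ ω' ∂P

/-- The field `J_I(μ) = ∫ μ(B(x,u)) (N - n_I)(dx, du)` of compensated Poisson integrals, where
`n_I` is `limitIntensity γ₁ γ₂`. -/
def limitField (γ₁ γ₂ : ℝ) (P : Measure Ω) (N : Ω → Measure ((ℝ × ℝ) × (ℝ × ℝ)))
    (μ : SignedMeasure (ℝ × ℝ)) : Ω → ℝ :=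
  compensatedIntegral P N (limitIntensity γ₁ γ₂) (boxMass μ)

end Fields

/-- Convergence of the finite-dimensional distributions of the random fields `X i`, indexed by
`T`, to those of the random field `Y` along the filter `l`. -/
def TendstoFDD {ι T : Type*} {Ω : ι → Type*} {Ω' : Type*} [∀ i, MeasurableSpace (Ω i)]
    [MeasurableSpace Ω'] (X : ∀ i, T → Ω i → ℝ) (l : Filter ι) (Y : T → Ω' → ℝ)
    (P : ∀ i, Measure (Ω i)) [∀ i, IsProbabilityMeasure (P i)]
    (P' : Measure Ω') [IsProbabilityMeasure P'] : Prop :=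
  ∀ (m : ℕ) (t : Fin m → T),
    TendstoInDistribution (fun i ω (k : Fin m) ↦ X i (t k) ω) l
      (fun ω (k : Fin m) ↦ Y (t k) ω) P P'

end

end RandomBoxes

namespace RandomBoxes

/-! Everything is read off characteristic functionals. For integrable `g` and ψ(y) = exp(iy) - 1 -
iy, a compensated Poisson integral satisfies E exp(i ∫ g d(N - n)) = exp(∫ ψ(g) dn): on simple
functions this is independence together with the Poisson characteristic function, and dominated
convergence does the rest (`IsPoissonRandomMeasure.integral_cexp`, `integral_cexp_centredIntegral`).

The same formula near frequency 0 bounds the L² norm of the compensated integral by 3 times that of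
`g` (`eLpNorm_centredIntegral_le`). Hence compensated integrals extend to square integrable
integrands by completeness (`exists_isCompensatedIntegral`), and the formula survives because |ψ(y)|
≤ 2y². Test measures have square integrable box masses under the limit intensity, so the limit field
exists and is linear.

Since both fields are linear and the test measures are closed under linear combinations, the
Cramér–Wold device and Lévy's continuity theorem (`tendstoInDistribution_of_tendsto_integral_cexp`)
reduce the convergence to that of ∫ ψ(μ(B(x,u))) under the scaled intensities for a single test
measure μ (`tendsto_integral_jumpExponent`). Integrating out x leaves a function φ(u) independent of
ρ and bounded by a constant times w₁(u₁)w₂(u₂), where wᵢ(u) = min(u, u^αᵢ). The scaled size density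
is λρ^(γ₁+γ₂), which tends to 1, times two one-dimensional rescaled densities. Each of these,
weighted by wᵢ, converges in L¹ to its power law (`tendsto_integral_abs_rescaledDensity_sub`): γᵢ >
1 controls large edges and αᵢ > γᵢ controls small ones. -/

theorem lintegral_map_cast_poissonMeasure (r : NNReal) :
    ∫⁻ x, x ∂((poissonMeasure r).map (Nat.cast : ℕ → ℝ≥0∞)) = r := by
  rw [lintegral_map (f := fun x ↦ x) measurable_id (by fun_prop)]
  have hs : HasSum (fun n : ℕ ↦ Real.exp (-r) * (r : ℝ) ^ n / n.factorial * n) r := by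
    -- The term n = 0 vanishes; after the shift, (n+1) r^(n+1)/(n+1)! is r times the Poisson weight
    -- at n.
    rw [← hasSum_nat_add_iff' 1]
    have h := (hasSum_one_poissonMeasure r).mul_left (r : ℝ)
    simp only [mul_one] at h
    simp only [Finset.range_one, Finset.sum_singleton, Nat.cast_zero, mul_zero, sub_zero]
    refine h.congr_fun fun n ↦ ?_
    rw [Nat.factorial_succ]
    push_cast
    field_simp
    exact pow_succ' _ _
  rw [poissonMeasure, lintegral_sum_measure]
  have : ∀ n : ℕ, ∫⁻ a, ((a : ℕ) : ℝ≥0∞)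
      ∂(ENNReal.ofReal (Real.exp (-r) * (r : ℝ) ^ n / n.factorial) • Measure.dirac n) =
      ENNReal.ofReal (Real.exp (-r) * (r : ℝ) ^ n / n.factorial * n) := by
    intro n
    rw [lintegral_smul_measure, lintegral_dirac, ENNReal.ofReal_mul (by positivity)]
    simp
  simp_rw [this]
  rw [← ENNReal.ofReal_tsum_of_nonneg (fun n ↦ by positivity) hs.summable, hs.tsum_eq]
  simp

/-! ### Poisson random measures: Campbell's formula and the characteristic functional. -/

section Poisson

variable {Ω E : Type*} [MeasurableSpace Ω] [MeasurableSpace E] {P : Measure Ω}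
  {N : Ω → Measure E} {n : Measure E}

namespace IsPoissonRandomMeasure

theorem measurable_apply (h : IsPoissonRandomMeasure P N n) {A : Set E} (hA : MeasurableSet A) :
    Measurable fun ω ↦ N ω A :=
  (Measure.measurable_coe hA).comp h.measurable

theorem lintegral_apply (h : IsPoissonRandomMeasure P N n) {A : Set E} (hA : MeasurableSet A)
    (hn : n A ≠ ∞) : ∫⁻ ω, N ω A ∂P = n A := by
  rw [(h.hasLaw A hA hn).lintegral_comp (f := fun x ↦ x) aemeasurable_id,
    lintegral_map_cast_poissonMeasure, ENNReal.coe_toNNReal hn]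

/-- The Poisson mean gives the identity on sets of finite measure; σ-finiteness cuts any set into
countably many disjoint such pieces. Campbell's formula for nonnegative integrands is then
integration against the mean measure. -/
theorem bind_eq [SigmaFinite n] (h : IsPoissonRandomMeasure P N n) : P.bind N = n := by
  ext A hA
  set S := disjointed (spanningSets n)
  have hS : ∀ i, MeasurableSet (A ∩ S i) := fun i ↦
    hA.inter (MeasurableSet.disjointed (measurableSet_spanningSets n) i)
  have hd : Pairwise (Function.onFun Disjoint fun i ↦ A ∩ S i) := fun i j hij ↦
    ((disjoint_disjointed _ hij).mono Set.inter_subset_right Set.inter_subset_right)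
  have hU : A = ⋃ i, A ∩ S i := by
    rw [← Set.inter_iUnion, iUnion_disjointed, iUnion_spanningSets, Set.inter_univ]
  rw [hU, measure_iUnion hd hS, measure_iUnion hd hS]
  refine tsum_congr fun i ↦ ?_
  rw [Measure.bind_apply (hS i) h.measurable.aemeasurable]
  refine h.lintegral_apply (hS i) (ne_top_of_le_ne_top (measure_spanningSets_lt_top n i).ne ?_)
  exact measure_mono (Set.inter_subset_right.trans (disjointed_subset _ _))

theorem lintegral_lintegral [SigmaFinite n] (h : IsPoissonRandomMeasure P N n) {g : E → ℝ≥0∞}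
    (hg : Measurable g) : ∫⁻ ω, ∫⁻ e, g e ∂(N ω) ∂P = ∫⁻ e, g e ∂n := by
  rw [← Measure.lintegral_bind h.measurable.aemeasurable hg.aemeasurable, h.bind_eq]

theorem ae_integrable [SigmaFinite n] (h : IsPoissonRandomMeasure P N n) {g : E → ℝ}
    (hg : Measurable g) (hi : Integrable g n) : ∀ᵐ ω ∂P, Integrable g (N ω) := by
  have h1 := h.lintegral_lintegral (g := fun e ↦ ‖g e‖ₑ) hg.enorm
  have h2 : Measurable fun ω ↦ ∫⁻ e, ‖g e‖ₑ ∂(N ω) :=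
    (Measure.measurable_lintegral hg.enorm).comp h.measurable
  filter_upwards [ae_lt_top h2 (by rw [h1]; exact hi.2.ne)] with ω hω
  exact ⟨hg.aestronglyMeasurable, hω⟩

theorem measurable_lintegral (h : IsPoissonRandomMeasure P N n) {g : E → ℝ≥0∞}
    (hg : Measurable g) : Measurable fun ω ↦ ∫⁻ e, g e ∂(N ω) :=
  (Measure.measurable_lintegral hg).comp h.measurable

theorem integrable_toReal_lintegral [SigmaFinite n] (h : IsPoissonRandomMeasure P N n) {g : E → ℝ}
    (hg : Measurable g) (hi : Integrable g n) :
    Integrable (fun ω ↦ (∫⁻ e, ENNReal.ofReal (g e) ∂(N ω)).toReal) P ∧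
    ∫ ω, (∫⁻ e, ENNReal.ofReal (g e) ∂(N ω)).toReal ∂P =
      (∫⁻ e, ENNReal.ofReal (g e) ∂n).toReal := by
  have hm := h.measurable_lintegral hg.ennreal_ofReal
  have h1 := h.lintegral_lintegral hg.ennreal_ofReal
  have hfin : ∫⁻ ω, ∫⁻ e, ENNReal.ofReal (g e) ∂(N ω) ∂P ≠ ∞ := by
    rw [h1]
    exact hi.lintegral_lt_top.ne
  refine ⟨integrable_toReal_of_lintegral_ne_top hm.aemeasurable hfin, ?_⟩
  rw [integral_toReal hm.aemeasurable (ae_lt_top hm hfin), h1]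

/-- The right-hand side is visibly measurable in ω and has known expectations, so measurability,
integrability and Campbell's formula for signed integrands all pass through it. -/
theorem integral_ae_eq [SigmaFinite n] (h : IsPoissonRandomMeasure P N n) {g : E → ℝ}
    (hg : Measurable g) (hi : Integrable g n) :
    (fun ω ↦ ∫ e, g e ∂(N ω)) =ᵐ[P] fun ω ↦ (∫⁻ e, ENNReal.ofReal (g e) ∂(N ω)).toReal -
      (∫⁻ e, ENNReal.ofReal (-g e) ∂(N ω)).toReal := by
  filter_upwards [h.ae_integrable hg hi] with ω hω
  exact integral_eq_lintegral_pos_part_sub_lintegral_neg_part hω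

theorem integrable_integral [SigmaFinite n] (h : IsPoissonRandomMeasure P N n) {g : E → ℝ}
    (hg : Measurable g) (hi : Integrable g n) : Integrable (fun ω ↦ ∫ e, g e ∂(N ω)) P :=
  ((h.integrable_toReal_lintegral hg hi).1.sub
    (h.integrable_toReal_lintegral hg.neg hi.neg).1).congr (h.integral_ae_eq hg hi).symm

theorem integral_integral [SigmaFinite n] (h : IsPoissonRandomMeasure P N n) {g : E → ℝ}
    (hg : Measurable g) (hi : Integrable g n) :
    ∫ ω, ∫ e, g e ∂(N ω) ∂P = ∫ e, g e ∂n := by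
  have h1 := h.integrable_toReal_lintegral hg hi
  have h2 := h.integrable_toReal_lintegral hg.neg hi.neg
  simp only [Pi.neg_apply] at h2
  rw [integral_congr_ae (h.integral_ae_eq hg hi), integral_sub h1.1 h2.1, h1.2, h2.2,
    integral_eq_lintegral_pos_part_sub_lintegral_neg_part hi]

theorem hasLaw_real (h : IsPoissonRandomMeasure P N n) {A : Set E} (hA : MeasurableSet A)
    (hn : n A ≠ ∞) :
    HasLaw (fun ω ↦ (N ω).real A) ((poissonMeasure (n A).toNNReal).map (Nat.cast : ℕ → ℝ)) P := by
  have h1 := h.hasLaw A hA hn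
  have h2 : HasLaw ENNReal.toReal ((poissonMeasure (n A).toNNReal).map (Nat.cast : ℕ → ℝ))
      ((poissonMeasure (n A).toNNReal).map (Nat.cast : ℕ → ℝ≥0∞)) := by
    refine ⟨by fun_prop, ?_⟩
    rw [Measure.map_map (by fun_prop) (by fun_prop)]
    congr 1
  exact h2.comp h1

/-- The characteristic functional on simple functions. -/
theorem integral_cexp_simpleFunc [IsProbabilityMeasure P] [SigmaFinite n]
    (h : IsPoissonRandomMeasure P N n)
    (g : SimpleFunc E ℝ) (hi : Integrable g n) :
    ∫ ω, Complex.exp ((∫ e, g e ∂(N ω) : ℝ) * Complex.I) ∂P =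
      Complex.exp (∫ e, (Complex.exp (g e * Complex.I) - 1) ∂n) := by
  classical
  -- The level set of the value 0 may have infinite intensity, so only nonzero values enter the sum.
  -- Their level sets are disjoint and of finite intensity, which yields independent Poisson counts.
  set s := g.range.filter (· ≠ 0) with hs
  set A : ℝ → Set E := fun c ↦ g ⁻¹' {c}
  have hA : ∀ c, MeasurableSet (A c) := fun c ↦ g.measurableSet_fiber c
  have hAn : ∀ c ∈ s, n (A c) ≠ ∞ := fun c hc ↦
    (SimpleFunc.integrable_iff.1 hi c (Finset.mem_filter.1 hc).2).ne
  let e := s.equivFin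
  have hind : iIndepFun (fun (c : s) ω ↦ N ω (A c)) P := by
    have := h.indep s.card (fun i ↦ A (e.symm i)) (fun i ↦ hA _) (fun i j hij ↦ by
      refine Disjoint.preimage _ (Set.disjoint_singleton.2 fun heq ↦ hij ?_)
      exact e.symm.injective (Subtype.ext heq))
    have h2 := this.precomp e.injective
    simpa using h2
  have hind2 : iIndepFun (fun (c : s) ω ↦ (N ω).real (A c) * (c : ℝ)) P :=
    hind.comp (fun c x ↦ x.toReal * (c : ℝ)) (fun c ↦ by fun_prop)
  have hmr : ∀ c : ℝ, Measurable fun ω ↦ (N ω).real (A c) := fun c ↦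
    (h.measurable_apply (hA c)).ennreal_toReal
  have hms : Measurable fun ω ↦ ∑ c : s, (N ω).real (A c) * (c : ℝ) :=
    Finset.measurable_fun_sum _ fun c _ ↦ (hmr c).mul_const _
  have hint : (fun ω ↦ ∫ x, g x ∂(N ω)) =ᵐ[P] fun ω ↦ ∑ c : s, (N ω).real (A c) * (c : ℝ) := by
    filter_upwards [h.ae_integrable g.measurable hi] with ω hω
    rw [← g.integral_eq_integral hω, SimpleFunc.integral_eq_sum_filter]
    rw [Finset.sum_coe_sort s (fun c ↦ (N ω).real (A c) * c)]
    simp [hs, A, smul_eq_mul]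
  have h3 := congrFun (iIndepFun.charFun_map_fun_sum_eq_prod (hX := hind2)
    (X := fun (c : s) ω ↦ (N ω).real (A c) * (c : ℝ))
    (fun c ↦ ((hmr c).mul_const _).aemeasurable)) 1
  have h4 : charFun (P.map fun ω ↦ ∑ c : s, (N ω).real (A c) * (c : ℝ)) 1 =
      ∫ ω, Complex.exp ((∫ e, g e ∂(N ω) : ℝ) * Complex.I) ∂P := by
    rw [charFun_apply_real, integral_map hms.aemeasurable (by fun_prop)]
    refine integral_congr_ae ?_
    filter_upwards [hint] with ω hω
    rw [hω]
    simp
  rw [← h4, h3, Finset.prod_apply]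
  have h5 : ∀ c : s, charFun (P.map fun ω ↦ (N ω).real (A c) * (c : ℝ)) 1 =
      Complex.exp (n.real (A c) * (Complex.exp ((c : ℝ) * Complex.I) - 1)) := by
    intro c
    have hl := h.hasLaw_real (hA c) (hAn c c.2)
    have : charFun (P.map fun ω ↦ (N ω).real (A c) * (c : ℝ)) 1 =
        charFun (P.map fun ω ↦ (N ω).real (A c)) c := by
      rw [charFun_apply_real, integral_map ((hmr c).mul_const _).aemeasurable (by fun_prop),
        charFun_apply_real, integral_map (hmr c).aemeasurable (by fun_prop)]
      congr 1 with ω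
      push_cast
      ring_nf
    rw [this, hl.map_eq, charFun_map_cast_poissonMeasure]
    rfl
  simp_rw [h5]
  rw [← Complex.exp_sum]
  congr 1
  have h6 := SimpleFunc.map_integral (μ := n) g
    (fun c : ℝ ↦ Complex.exp (c * Complex.I) - 1) hi (by simp)
  have h7 : Integrable (g.map fun c : ℝ ↦ Complex.exp (c * Complex.I) - 1) n := by
    refine SimpleFunc.integrable_iff_finMeasSupp.2 ?_
    exact (SimpleFunc.integrable_iff_finMeasSupp.1 hi).map (by simp)
  rw [SimpleFunc.integral_eq_integral _ h7] at h6
  simp only [SimpleFunc.coe_map, Function.comp_apply] at h6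
  -- The value 0 may be added back at no cost, since exp(0) - 1 = 0.
  rw [h6, Finset.sum_coe_sort s
    (fun c ↦ (n.real (A c) : ℂ) * (Complex.exp ((c : ℝ) * Complex.I) - 1)), hs,
    Finset.sum_filter_of_ne]
  · rfl
  · rintro c - hc rfl
    simp at hc

/-- The characteristic functional of a Poisson random measure. -/
theorem integral_cexp [IsProbabilityMeasure P] [SigmaFinite n] (h : IsPoissonRandomMeasure P N n)
    {g : E → ℝ} (hg : Measurable g) (hi : Integrable g n) :
    ∫ ω, Complex.exp ((∫ e, g e ∂(N ω) : ℝ) * Complex.I) ∂P =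
      Complex.exp (∫ e, (Complex.exp (g e * Complex.I) - 1) ∂n) := by
  set s : ℕ → SimpleFunc E ℝ := fun k ↦
    SimpleFunc.approxOn g hg Set.univ 0 (Set.mem_univ _) k
  have hsn : ∀ k e, ‖s k e‖ ≤ ‖g e‖ + ‖g e‖ := fun k e ↦
    SimpleFunc.norm_approxOn_zero_le hg (Set.mem_univ _) e k
  have hst : ∀ e, Tendsto (fun k ↦ s k e) atTop (𝓝 (g e)) := fun e ↦
    SimpleFunc.tendsto_approxOn hg (Set.mem_univ _) (by simp)
  have hsi : ∀ k, Integrable (s k) n := fun k ↦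
    (hi.norm.add hi.norm).mono' (s k).measurable.aestronglyMeasurable (ae_of_all _ (hsn k))
  have hl : Tendsto (fun k ↦ ∫ ω, Complex.exp ((∫ e, s k e ∂(N ω) : ℝ) * Complex.I) ∂P) atTop
      (𝓝 (∫ ω, Complex.exp ((∫ e, g e ∂(N ω) : ℝ) * Complex.I) ∂P)) := by
    refine tendsto_integral_of_dominated_convergence (fun _ ↦ 1) (fun k ↦ ?_)
      (integrable_const _) (fun k ↦ ae_of_all _ fun ω ↦ ?_) ?_
    · have := (h.integrable_integral (s k).measurable (hsi k)).aestronglyMeasurable.aemeasurable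
      exact AEMeasurable.aestronglyMeasurable (by fun_prop)
    · rw [Complex.norm_exp_ofReal_mul_I]
    · filter_upwards [h.ae_integrable hg hi] with ω hω
      have : Tendsto (fun k ↦ ∫ e, s k e ∂(N ω)) atTop (𝓝 (∫ e, g e ∂(N ω))) :=
        tendsto_integral_of_dominated_convergence (fun e ↦ ‖g e‖ + ‖g e‖)
          (fun k ↦ (s k).measurable.aestronglyMeasurable) (hω.norm.add hω.norm)
          (fun k ↦ ae_of_all _ (hsn k)) (ae_of_all _ hst)
      exact (Complex.continuous_exp.comp
        (Complex.continuous_ofReal.mul continuous_const)).continuousAt.tendsto.comp this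
  have hr : Tendsto (fun k ↦ Complex.exp (∫ e, (Complex.exp (s k e * Complex.I) - 1) ∂n)) atTop
      (𝓝 (Complex.exp (∫ e, (Complex.exp (g e * Complex.I) - 1) ∂n))) := by
    refine (Complex.continuous_exp.tendsto _).comp ?_
    -- Domination comes from |exp(iy) - 1| ≤ |y| and the bound of the approximants by 2|g|.
    refine tendsto_integral_of_dominated_convergence (fun e ↦ ‖g e‖ + ‖g e‖) (fun k ↦ ?_)
      (hi.norm.add hi.norm) (fun k ↦ ae_of_all _ fun e ↦ ?_) (ae_of_all _ fun e ↦ ?_)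
    · have := (s k).measurable
      exact Measurable.aestronglyMeasurable (by fun_prop)
    · rw [mul_comm]
      exact Real.norm_exp_I_mul_ofReal_sub_one_le.trans (hsn k e)
    · exact ((Complex.continuous_exp.comp (Complex.continuous_ofReal.mul
        continuous_const)).sub continuous_const).continuousAt.tendsto.comp (hst e)
  refine tendsto_nhds_unique hl (hr.congr fun k ↦ ?_)
  rw [h.integral_cexp_simpleFunc (s k) (hsi k)]

end IsPoissonRandomMeasure

end Poisson

/-! ### Compensated integrals of integrable functions: exponent and L² bound. -/

/-- The Lévy–Khinchine exponent `exp (i y) - 1 - i y` of the compensated jump `y`. -/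
noncomputable def jumpExponent (y : ℝ) : ℂ := Complex.exp (y * Complex.I) - 1 - y * Complex.I

theorem continuous_jumpExponent : Continuous jumpExponent := by
  unfold jumpExponent; fun_prop

/-- For |y| ≤ 1 this is the second-order Taylor bound; for |y| > 1 the crude bound 2|y| suffices. -/
theorem norm_jumpExponent_le (y : ℝ) : ‖jumpExponent y‖ ≤ 2 * y ^ 2 := by
  unfold jumpExponent
  have hy : ‖(y : ℂ) * Complex.I‖ = |y| := by simp
  rcases le_or_gt |y| 1 with h | h
  · have := Complex.norm_exp_sub_one_sub_id_le (x := y * Complex.I) (by rwa [hy])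
    rw [hy, sq_abs] at this
    nlinarith [sq_nonneg y]
  · have h1 : ‖Complex.exp (y * Complex.I) - 1‖ ≤ |y| := by
      rw [mul_comm]; exact Real.norm_exp_I_mul_ofReal_sub_one_le
    have h2 := norm_sub_le (Complex.exp (y * Complex.I) - 1) (y * Complex.I)
    rw [hy] at h2
    nlinarith [sq_abs y]

theorem eLpNorm_two_eq_ofReal_sqrt {α : Type*} [MeasurableSpace α] {μ : Measure α} {f : α → ℝ}
    (hf : MemLp f 2 μ) : eLpNorm f 2 μ = ENNReal.ofReal √(∫ x, f x ^ 2 ∂μ) := by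
  rw [hf.eLpNorm_eq_integral_rpow_norm (by norm_num) (by norm_num), Real.sqrt_eq_rpow]
  simp

section Poisson

variable {Ω E : Type*} [MeasurableSpace Ω] [MeasurableSpace E] {P : Measure Ω}
  {N : Ω → Measure E} {n : Measure E}

/-- The compensated integral `∫ g dN - ∫ g dn` of an integrable function. -/
noncomputable def centredIntegral (N : Ω → Measure E) (n : Measure E) (g : E → ℝ) (ω : Ω) : ℝ :=
  ∫ e, g e ∂(N ω) - ∫ e, g e ∂n

namespace IsPoissonRandomMeasure

variable [SigmaFinite n]

theorem centredIntegral_linearCombination (h : IsPoissonRandomMeasure P N n)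
    {g₁ g₂ : E → ℝ} (hg₁ : Measurable g₁) (hi₁ : Integrable g₁ n) (hg₂ : Measurable g₂)
    (hi₂ : Integrable g₂ n) (a b : ℝ) :
    centredIntegral N n (a • g₁ + b • g₂) =ᵐ[P]
      a • centredIntegral N n g₁ + b • centredIntegral N n g₂ := by
  filter_upwards [h.ae_integrable hg₁ hi₁, h.ae_integrable hg₂ hi₂] with ω h₁ h₂
  simp only [centredIntegral, Pi.add_apply, Pi.smul_apply, smul_eq_mul]
  rw [integral_add (h₁.const_mul a) (h₂.const_mul b),
    integral_add (hi₁.const_mul a) (hi₂.const_mul b)]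
  simp only [integral_const_mul]
  ring

variable [IsProbabilityMeasure P]

theorem integrable_centredIntegral (h : IsPoissonRandomMeasure P N n)
    {g : E → ℝ} (hg : Measurable g) (hi : Integrable g n) :
    Integrable (centredIntegral N n g) P :=
  (h.integrable_integral hg hi).sub (integrable_const _)

theorem integral_cexp_centredIntegral (h : IsPoissonRandomMeasure P N n)
    {g : E → ℝ} (hg : Measurable g) (hi : Integrable g n) :
    ∫ ω, Complex.exp (centredIntegral N n g ω * Complex.I) ∂P =
      Complex.exp (∫ e, jumpExponent (g e) ∂n) := by
  have h1 : ∀ ω, Complex.exp (centredIntegral N n g ω * Complex.I) =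
      Complex.exp ((∫ e, g e ∂(N ω) : ℝ) * Complex.I) *
        Complex.exp (-((∫ e, g e ∂n : ℝ) * Complex.I)) := by
    intro ω
    rw [← Complex.exp_add, centredIntegral]
    push_cast
    ring_nf
  simp_rw [h1]
  rw [integral_mul_const, h.integral_cexp hg hi, ← Complex.exp_add]
  congr 1
  have h2 : Integrable (fun e ↦ Complex.exp (g e * Complex.I) - 1) n := by
    refine hi.norm.mono' (Measurable.aestronglyMeasurable (by fun_prop)) (ae_of_all _ fun e ↦ ?_)
    rw [mul_comm]
    exact Real.norm_exp_I_mul_ofReal_sub_one_le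
  have h3 : Integrable (fun e ↦ (g e : ℂ) * Complex.I) n := hi.ofReal.mul_const _
  simp only [jumpExponent]
  rw [integral_sub h2 h3, integral_mul_const, integral_complex_ofReal]
  ring

/-- The bounded variable 2 sin(tX/2)/t replaces X, whose square integrability is not yet known. Its
square is (2/t²)(1 - cos tX), so its expectation is given by the real part of the characteristic
function at t. The smallness of t puts the exponent z in the unit disc, where |exp z - 1| ≤ 2|z|;
this gives 8 ∫ g² dn ≤ 3² ∫ g² dn. -/
theorem eLpNorm_sin_centredIntegral_le (h : IsPoissonRandomMeasure P N n)
    {g : E → ℝ} (hg : Measurable g) (hi : Integrable g n) (h2 : MemLp g 2 n) {t : ℝ} (ht : 0 < t)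
    (htg : t ^ 2 * (2 * ∫ e, g e ^ 2 ∂n) ≤ 1) :
    eLpNorm (fun ω ↦ 2 * Real.sin (t * centredIntegral N n g ω / 2) / t) 2 P ≤
      3 * eLpNorm g 2 n := by
  have hXm := (h.integrable_centredIntegral hg hi).aestronglyMeasurable.aemeasurable
  set X := centredIntegral N n g
  have hY : MemLp (fun ω ↦ 2 * Real.sin (t * X ω / 2) / t) 2 P := by
    refine MemLp.of_bound (AEMeasurable.aestronglyMeasurable (by fun_prop)) (2 / t)
      (ae_of_all _ fun ω ↦ ?_)
    rw [norm_div, norm_mul, Real.norm_of_nonneg ht.le]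
    gcongr
    have := Real.abs_sin_le_one (t * X ω / 2)
    simp only [Real.norm_eq_abs]
    norm_num
    exact this
  rw [eLpNorm_two_eq_ofReal_sqrt hY, eLpNorm_two_eq_ofReal_sqrt h2]
  have hS : 0 ≤ ∫ e, g e ^ 2 ∂n := integral_nonneg fun e ↦ sq_nonneg _
  set S := ∫ e, g e ^ 2 ∂n
  rw [show (3 : ℝ≥0∞) = ENNReal.ofReal 3 by norm_num, ← ENNReal.ofReal_mul (by norm_num)]
  refine ENNReal.ofReal_le_ofReal (Real.sqrt_le_iff.2 ⟨by positivity, ?_⟩)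
  rw [mul_pow, Real.sq_sqrt hS]
  have hz := h.integral_cexp_centredIntegral (g := t • g) (hg.const_smul t) (hi.smul t)
  have hsm : centredIntegral N n (t • g) = t • X := by
    ext ω
    simp [centredIntegral, X, integral_const_mul, mul_sub]
  rw [hsm] at hz
  set z := ∫ e, jumpExponent ((t • g) e) ∂n
  have hzn : ‖z‖ ≤ t ^ 2 * (2 * S) := by
    calc ‖z‖ ≤ ∫ e, 2 * (t ^ 2 * g e ^ 2) ∂n := by
          refine norm_integral_le_of_norm_le ((h2.integrable_sq.const_mul _).const_mul _)
            (ae_of_all _ fun e ↦ ?_)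
          rw [← mul_pow]
          exact norm_jumpExponent_le _
      _ = t ^ 2 * (2 * S) := by simp only [integral_const_mul]; ring
  have hcos : ∫ ω, Real.cos (t * X ω) ∂P = (Complex.exp z).re := by
    rw [← hz]
    have hint : Integrable (fun ω ↦ Complex.exp (((t • X) ω : ℝ) * Complex.I)) P := by
      refine (integrable_const (1 : ℝ)).mono'
        (AEMeasurable.aestronglyMeasurable ?_) (ae_of_all _ fun ω ↦ ?_)
      · simp only [Pi.smul_apply, smul_eq_mul]; fun_prop
      · rw [Complex.norm_exp_ofReal_mul_I]
    have := integral_re hint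
    simp only [RCLike.re_to_complex] at this
    rw [← this]
    simp only [Complex.exp_ofReal_mul_I_re, Pi.smul_apply, smul_eq_mul]
  have hci : Integrable (fun ω ↦ Real.cos (t * X ω)) P :=
    (integrable_const (1 : ℝ)).mono' (AEMeasurable.aestronglyMeasurable (by fun_prop))
      (ae_of_all _ fun ω ↦ Real.abs_cos_le_one _)
  have hsq : ∀ ω, (2 * Real.sin (t * X ω / 2) / t) ^ 2 =
      2 / t ^ 2 * (1 - Real.cos (t * X ω)) := by
    intro ω
    have h5 := Real.cos_sq (t * X ω / 2)
    have h6 := Real.sin_sq_add_cos_sq (t * X ω / 2)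
    rw [mul_div_cancel₀ _ (by norm_num : (2 : ℝ) ≠ 0)] at h5
    have h7 : Real.sin (t * X ω / 2) ^ 2 = (1 - Real.cos (t * X ω)) / 2 := by linarith
    rw [div_pow, mul_pow, h7]
    ring
  simp_rw [hsq]
  rw [integral_const_mul, integral_sub (integrable_const _) hci, hcos]
  simp only [integral_const, probReal_univ, smul_eq_mul, mul_one]
  have h8 : 1 - (Complex.exp z).re ≤ 2 * (t ^ 2 * (2 * S)) := by
    have h9 := Complex.norm_exp_sub_one_le (hzn.trans htg)
    have h10 := Complex.abs_re_le_norm (Complex.exp z - 1)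
    simp only [Complex.sub_re, Complex.one_re] at h10
    have := neg_abs_le ((Complex.exp z).re - 1)
    linarith
  calc 2 / t ^ 2 * (1 - (Complex.exp z).re) ≤ 2 / t ^ 2 * (2 * (t ^ 2 * (2 * S))) := by gcongr
    _ = 8 * S := by field_simp; ring
    _ ≤ 3 ^ 2 * S := by nlinarith

/-- The second moment of a compensated integral is controlled by the intensity. -/
theorem eLpNorm_centredIntegral_le (h : IsPoissonRandomMeasure P N n)
    {g : E → ℝ} (hg : Measurable g) (hi : Integrable g n) (h2 : MemLp g 2 n) :
    eLpNorm (centredIntegral N n g) 2 P ≤ 3 * eLpNorm g 2 n := by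
  have hXm := (h.integrable_centredIntegral hg hi).aestronglyMeasurable.aemeasurable
  have hev : ∀ᶠ t : ℝ in 𝓝[>] 0, t ^ 2 * (2 * ∫ e, g e ^ 2 ∂n) ≤ 1 := by
    have : Tendsto (fun t : ℝ ↦ t ^ 2 * (2 * ∫ e, g e ^ 2 ∂n)) (𝓝[>] 0) (𝓝 0) := by
      have hc : Continuous fun t : ℝ ↦ t ^ 2 * (2 * ∫ e, g e ^ 2 ∂n) := by fun_prop
      simpa using (hc.tendsto 0).mono_left nhdsWithin_le_nhds
    exact this.eventually_le_const one_pos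
  -- Fatou as t ↓ 0: the quotients 2 sin(tX/2)/t converge pointwise to X, being slopes at 0 of a
  -- function with derivative X there.
  refine Lp.eLpNorm_le_of_ae_tendsto (u := 𝓝[>] (0 : ℝ))
    (f := fun t ω ↦ 2 * Real.sin (t * centredIntegral N n g ω / 2) / t) ?_ (fun t ↦ ?_)
    (ae_of_all _ fun ω ↦ ?_)
  · filter_upwards [hev, self_mem_nhdsWithin] with t ht ht0
    exact h.eLpNorm_sin_centredIntegral_le hg hi h2 ht0 ht
  · exact AEMeasurable.aestronglyMeasurable (by fun_prop)
  · set x := centredIntegral N n g ω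
    have hd : HasDerivAt (fun t : ℝ ↦ 2 * Real.sin (t * x / 2)) x 0 := by
      have h1 : HasDerivAt (fun t : ℝ ↦ t * x / 2) (x / 2) 0 := by
        simpa using ((hasDerivAt_id (0 : ℝ)).mul_const x).div_const 2
      have := (h1.sin).const_mul 2
      simpa [mul_div_cancel₀] using this
    have := hd.tendsto_slope.mono_left (nhdsWithin_mono 0 fun t (ht : 0 < t) ↦ ht.ne')
    refine this.congr fun t ↦ ?_
    simp [slope_def_field]

end IsPoissonRandomMeasure

end Poisson

/-! ### Compensated integrals of square integrable functions. -/

section Poisson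

variable {Ω E : Type*} [MeasurableSpace Ω] [MeasurableSpace E] {P : Measure Ω}
  {N : Ω → Measure E} {n : Measure E}

theorem isCompensatedIntegral_compensatedIntegral {f : E → ℝ}
    (h : ∃ X, IsCompensatedIntegral P N n f X) :
    IsCompensatedIntegral P N n f (compensatedIntegral P N n f) := by
  unfold compensatedIntegral
  rw [dif_pos h]
  exact h.choose_spec

theorem memLp_of_abs_le {p : ℝ≥0∞} {f g : E → ℝ} (hf : MemLp f p n) (hg : Measurable g)
    (hgf : ∀ e, |g e| ≤ |f e|) : MemLp g p n :=
  hf.mono hg.aestronglyMeasurable (ae_of_all _ hgf)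

theorem tendsto_eLpNorm_sub_of_abs_le {f : E → ℝ} (hfm : Measurable f) (hf : MemLp f 2 n)
    {g : ℕ → E → ℝ} (hg : ∀ k, Measurable (g k)) (hgf : ∀ k e, |g k e| ≤ |f e|)
    (hlim : ∀ e, Tendsto (fun k ↦ g k e) atTop (𝓝 (f e))) :
    Tendsto (fun k ↦ eLpNorm (g k - f) 2 n) atTop (𝓝 0) := by
  have hm : ∀ k, MemLp (g k - f) 2 n := fun k ↦ (memLp_of_abs_le hf (hg k) (hgf k)).sub hf
  simp_rw [fun k ↦ eLpNorm_two_eq_ofReal_sqrt (hm k)]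
  have : Tendsto (fun k ↦ ∫ e, (g k - f) e ^ 2 ∂n) atTop (𝓝 (∫ _, (0 : ℝ) ∂n)) := by
    refine tendsto_integral_of_dominated_convergence (fun e ↦ 4 * f e ^ 2)
      (fun k ↦ (((hg k).sub hfm).pow_const 2).aestronglyMeasurable)
      (hf.integrable_sq.const_mul 4) (fun k ↦ ae_of_all _ fun e ↦ ?_) (ae_of_all _ fun e ↦ ?_)
    · have h1 := abs_sub (g k e) (f e)
      have h2 := hgf k e
      have h3 := abs_nonneg (g k e - f e)
      simp only [Pi.sub_apply, norm_pow, Real.norm_eq_abs]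
      rw [← sq_abs (f e)]
      nlinarith
    · have := ((hlim e).sub_const (f e)).pow 2
      simpa using this
  have h2 := (ENNReal.continuous_ofReal.comp Real.continuous_sqrt).continuousAt.tendsto.comp this
  simpa using! h2

/-- Truncation of a function to sets of finite measure exhausting the space. -/
noncomputable def truncation (n : Measure E) [SigmaFinite n] (f : E → ℝ) (k : ℕ) : E → ℝ :=
  (spanningSets n k).indicator f

section truncation

variable [SigmaFinite n] {f : E → ℝ}

theorem measurable_truncation (hfm : Measurable f) (k : ℕ) : Measurable (truncation n f k) :=
  hfm.indicator (measurableSet_spanningSets n k)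

theorem abs_truncation_le (k : ℕ) (e : E) : |truncation n f k e| ≤ |f e| := by
  unfold truncation
  by_cases h : e ∈ spanningSets n k <;> simp [h]

theorem tendsto_truncation (e : E) : Tendsto (fun k ↦ truncation n f k e) atTop (𝓝 (f e)) := by
  refine tendsto_const_nhds.congr' ?_
  filter_upwards [eventually_ge_atTop (spanningSetsIndex n e)] with k hk
  exact (Set.indicator_of_mem (mem_spanningSets_of_index_le n e hk) f).symm

/-- On a set of finite measure L² embeds in L¹, so cutting the domain alone already produces
admissible approximants. -/
theorem integrable_truncation (hf : MemLp f 2 n) (k : ℕ) : Integrable (truncation n f k) n := by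
  refine (integrable_indicator_iff (measurableSet_spanningSets n k)).2 ?_
  have : IsFiniteMeasure (n.restrict (spanningSets n k)) :=
    ⟨by simpa using measure_spanningSets_lt_top n k⟩
  exact (hf.restrict _).integrable (by norm_num)

end truncation

variable [SigmaFinite n]

theorem IsCompensatedIntegral.tendsto_truncation {f : E → ℝ} {X : Ω → ℝ}
    (hX : IsCompensatedIntegral P N n f X) (hfm : Measurable f) (hf : MemLp f 2 n) :
    TendstoInMeasure P (fun k ↦ centredIntegral N n (truncation n f k)) atTop X :=
  hX.tendsto (truncation n f) (measurable_truncation hfm) (integrable_truncation hf)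
    abs_truncation_le RandomBoxes.tendsto_truncation

/-- Truncation to a fixed set is linear in the integrand, and the three compensated integrals are
limits along the same truncations. Successive subsequences turn convergence in probability into
simultaneous almost sure convergence. -/
theorem IsCompensatedIntegral.linearCombination (h : IsPoissonRandomMeasure P N n)
    {f₁ f₂ : E → ℝ} (hm₁ : Measurable f₁) (hL₁ : MemLp f₁ 2 n) (hm₂ : Measurable f₂)
    (hL₂ : MemLp f₂ 2 n) {X₁ X₂ X : Ω → ℝ} (hX₁ : IsCompensatedIntegral P N n f₁ X₁)
    (hX₂ : IsCompensatedIntegral P N n f₂ X₂) {a b : ℝ}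
    (hX : IsCompensatedIntegral P N n (a • f₁ + b • f₂) X) : X =ᵐ[P] a • X₁ + b • X₂ := by
  have t₁ := hX₁.tendsto_truncation hm₁ hL₁
  have t₂ := hX₂.tendsto_truncation hm₂ hL₂
  have t := hX.tendsto_truncation ((hm₁.const_smul a).add (hm₂.const_smul b))
    ((hL₁.const_smul a).add (hL₂.const_smul b))
  obtain ⟨s₁, hs₁, ha₁⟩ := t₁.exists_seq_tendsto_ae
  obtain ⟨s₂, hs₂, ha₂⟩ := (t₂.comp hs₁.tendsto_atTop).exists_seq_tendsto_ae
  obtain ⟨s₃, hs₃, ha₃⟩ :=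
    (t.comp (hs₁.tendsto_atTop.comp hs₂.tendsto_atTop)).exists_seq_tendsto_ae
  have hlin : ∀ k, centredIntegral N n (truncation n (a • f₁ + b • f₂) k) =ᵐ[P]
      a • centredIntegral N n (truncation n f₁ k) +
        b • centredIntegral N n (truncation n f₂ k) := by
    intro k
    have : truncation n (a • f₁ + b • f₂) k = a • truncation n f₁ k + b • truncation n f₂ k := by
      ext e
      unfold truncation
      by_cases he : e ∈ spanningSets n k <;> simp [he]
    rw [this]
    exact h.centredIntegral_linearCombination (measurable_truncation hm₁ k)
      (integrable_truncation hL₁ k) (measurable_truncation hm₂ k) (integrable_truncation hL₂ k) a b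
  filter_upwards [ha₁, ha₂, ha₃, ae_all_iff.2 hlin] with ω h1 h2 h3 h4
  have h5 := ((h1.comp (hs₂.tendsto_atTop.comp hs₃.tendsto_atTop)).const_smul a).add
    ((h2.comp hs₃.tendsto_atTop).const_smul b)
  refine tendsto_nhds_unique h3 (h5.congr fun k ↦ ?_)
  exact (h4 _).symm

variable [IsProbabilityMeasure P]

theorem eLpNorm_centredIntegral_sub_le (h : IsPoissonRandomMeasure P N n) {g₁ g₂ : E → ℝ}
    (hg₁ : Measurable g₁) (hi₁ : Integrable g₁ n) (h₁ : MemLp g₁ 2 n)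
    (hg₂ : Measurable g₂) (hi₂ : Integrable g₂ n) (h₂ : MemLp g₂ 2 n) :
    eLpNorm (centredIntegral N n g₁ - centredIntegral N n g₂) 2 P ≤
      3 * eLpNorm (g₁ - g₂) 2 n := by
  have h1 := h.centredIntegral_linearCombination hg₁ hi₁ hg₂ hi₂ 1 (-1)
  simp only [one_smul, neg_smul, ← sub_eq_add_neg] at h1
  rw [← eLpNorm_congr_ae h1]
  exact h.eLpNorm_centredIntegral_le (hg₁.sub hg₂) (hi₁.sub hi₂) (h₁.sub h₂)

/-- The compensated integral of a square integrable function exists. -/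
theorem exists_isCompensatedIntegral (h : IsPoissonRandomMeasure P N n) {f : E → ℝ}
    (hfm : Measurable f) (hf : MemLp f 2 n) : ∃ X, IsCompensatedIntegral P N n f X := by
  set g := truncation n f
  have hgm : ∀ k, Measurable (g k) := measurable_truncation hfm
  have hgi : ∀ k, Integrable (g k) n := integrable_truncation hf
  have hgL : ∀ k, MemLp (g k) 2 n := fun k ↦ memLp_of_abs_le hf (hgm k) (abs_truncation_le k)
  have hgt := tendsto_eLpNorm_sub_of_abs_le hfm hf hgm abs_truncation_le tendsto_truncation
  have hXL : ∀ k, MemLp (centredIntegral N n (g k)) 2 P := fun k ↦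
    ⟨(h.integrable_centredIntegral (hgm k) (hgi k)).aestronglyMeasurable,
      (h.eLpNorm_centredIntegral_le (hgm k) (hgi k) (hgL k)).trans_lt
        (ENNReal.mul_lt_top (by norm_num) (hgL k).2)⟩
  have hc1 : CauchySeq fun k ↦ (hgL k).toLp (g k) :=
    ((Lp.tendsto_Lp_iff_tendsto_eLpNorm'' g hgL f hf).2 hgt).cauchySeq
  have hc2 : CauchySeq fun k ↦ (hXL k).toLp (centredIntegral N n (g k)) := by
    rw [Metric.cauchySeq_iff] at hc1 ⊢
    intro ε hε
    -- The 3 is the constant of the L² bound.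
    obtain ⟨K, hK⟩ := hc1 (ε / 3) (by positivity)
    refine ⟨K, fun i hi j hj ↦ ?_⟩
    have h1 := hK i hi j hj
    rw [Lp.dist_def, eLpNorm_congr_ae ((hgL i).coeFn_toLp.sub (hgL j).coeFn_toLp)] at h1
    rw [Lp.dist_def, eLpNorm_congr_ae ((hXL i).coeFn_toLp.sub (hXL j).coeFn_toLp)]
    have h2 := ENNReal.toReal_mono
      (ENNReal.mul_ne_top (by norm_num) ((hgL i).sub (hgL j)).2.ne)
      (eLpNorm_centredIntegral_sub_le h (hgm i) (hgi i) (hgL i) (hgm j) (hgi j) (hgL j))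
    rw [ENNReal.toReal_mul, ENNReal.toReal_ofNat] at h2
    linarith
  obtain ⟨L, hL⟩ := cauchySeq_tendsto_of_complete hc2
  rw [Lp.tendsto_Lp_iff_tendsto_eLpNorm'] at hL
  have hL' : Tendsto (fun k ↦ eLpNorm (centredIntegral N n (g k) - ⇑L) 2 P) atTop (𝓝 0) := by
    refine hL.congr fun k ↦ eLpNorm_congr_ae ?_
    exact (hXL k).coeFn_toLp.sub (EventuallyEq.refl _ _)
  refine ⟨L, (Lp.stronglyMeasurable L).measurable, fun g' hg'm hg'i hg'f hg'l ↦ ?_⟩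
  have hg'L : ∀ k, MemLp (g' k) 2 n := fun k ↦ memLp_of_abs_le hf (hg'm k) (hg'f k)
  have hg't := tendsto_eLpNorm_sub_of_abs_le hfm hf hg'm hg'f hg'l
  have hX'm : ∀ k, AEStronglyMeasurable (centredIntegral N n (g' k)) P := fun k ↦
    (h.integrable_centredIntegral (hg'm k) (hg'i k)).aestronglyMeasurable
  refine tendstoInMeasure_of_tendsto_eLpNorm (p := 2) (by norm_num)
    (f := fun k ↦ centredIntegral N n (g' k)) hX'm (Lp.aestronglyMeasurable L) ?_
  -- The limit `L` was built from truncations; any other admissible sequence has the same limit,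
  -- because its L² distance to the truncations tends to 0.
  have hb : Tendsto (fun k ↦ 3 * (eLpNorm (g' k - f) 2 n + eLpNorm (g k - f) 2 n) +
      eLpNorm (centredIntegral N n (g k) - ⇑L) 2 P) atTop (𝓝 0) := by
    have := (ENNReal.Tendsto.const_mul (hg't.add hgt) (Or.inr (by norm_num : (3 : ℝ≥0∞) ≠ ∞))).add hL'
    simpa using this
  refine tendsto_of_tendsto_of_tendsto_of_le_of_le tendsto_const_nhds hb (fun _ ↦ zero_le)
    fun k ↦ ?_
  have e1 : centredIntegral N n (g' k) - ⇑L =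
      (centredIntegral N n (g' k) - centredIntegral N n (g k)) +
        (centredIntegral N n (g k) - ⇑L) := by abel
  have e2 : g' k - g k = (g' k - f) - (g k - f) := by abel
  calc eLpNorm (centredIntegral N n (g' k) - ⇑L) 2 P
      ≤ eLpNorm (centredIntegral N n (g' k) - centredIntegral N n (g k)) 2 P +
        eLpNorm (centredIntegral N n (g k) - ⇑L) 2 P := by
        rw [e1]
        exact eLpNorm_add_le ((hX'm k).sub (hXL k).1) ((hXL k).1.sub (Lp.aestronglyMeasurable L))
          (by norm_num)
    _ ≤ _ := by
        gcongr
        refine (eLpNorm_centredIntegral_sub_le h (hg'm k) (hg'i k) (hg'L k) (hgm k) (hgi k)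
          (hgL k)).trans ?_
        gcongr
        rw [e2]
        exact eLpNorm_sub_le ((hg'L k).sub hf).1 ((hgL k).sub hf).1 (by norm_num)

/-- Both sides pass to the limit along an almost surely convergent subsequence of truncations,
dominated by 1 on the left and by 2f² in the exponent. -/
theorem IsCompensatedIntegral.integral_cexp (h : IsPoissonRandomMeasure P N n)
    {f : E → ℝ} (hfm : Measurable f) (hf : MemLp f 2 n) {X : Ω → ℝ}
    (hX : IsCompensatedIntegral P N n f X) :
    ∫ ω, Complex.exp (X ω * Complex.I) ∂P = Complex.exp (∫ e, jumpExponent (f e) ∂n) := by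
  obtain ⟨s, hs, ha⟩ := (hX.tendsto_truncation hfm hf).exists_seq_tendsto_ae
  have hl : Tendsto (fun k ↦ ∫ ω, Complex.exp
      (centredIntegral N n (truncation n f (s k)) ω * Complex.I) ∂P) atTop
      (𝓝 (∫ ω, Complex.exp (X ω * Complex.I) ∂P)) := by
    refine tendsto_integral_of_dominated_convergence (fun _ ↦ 1) (fun k ↦ ?_)
      (integrable_const _) (fun k ↦ ae_of_all _ fun ω ↦ ?_) ?_
    · have := (h.integrable_centredIntegral (measurable_truncation hfm (s k))
        (integrable_truncation hf (s k))).aestronglyMeasurable.aemeasurable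
      exact AEMeasurable.aestronglyMeasurable (by fun_prop)
    · rw [Complex.norm_exp_ofReal_mul_I]
    · filter_upwards [ha] with ω hω
      exact (Complex.continuous_exp.comp
        (Complex.continuous_ofReal.mul continuous_const)).continuousAt.tendsto.comp hω
  have hr : Tendsto (fun k ↦ Complex.exp (∫ e, jumpExponent (truncation n f (s k) e) ∂n)) atTop
      (𝓝 (Complex.exp (∫ e, jumpExponent (f e) ∂n))) := by
    refine (Complex.continuous_exp.tendsto _).comp ?_
    refine tendsto_integral_of_dominated_convergence (fun e ↦ 2 * f e ^ 2) (fun k ↦ ?_)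
      (hf.integrable_sq.const_mul 2) (fun k ↦ ae_of_all _ fun e ↦ ?_) (ae_of_all _ fun e ↦ ?_)
    · exact (continuous_jumpExponent.measurable.comp
        (measurable_truncation hfm (s k))).aestronglyMeasurable
    · refine (norm_jumpExponent_le _).trans ?_
      gcongr 2 * ?_
      exact sq_le_sq.2 (abs_truncation_le _ _)
    · exact (continuous_jumpExponent.tendsto _).comp
        ((RandomBoxes.tendsto_truncation e).comp hs.tendsto_atTop)
  refine tendsto_nhds_unique hl (hr.congr fun k ↦ ?_)
  rw [h.integral_cexp_centredIntegral (measurable_truncation hfm (s k))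
    (integrable_truncation hf (s k))]

end Poisson

/-! ### Box masses and the space of test measures. -/

theorem measurableSet_mem_box :
    MeasurableSet {q : ((ℝ × ℝ) × (ℝ × ℝ)) × (ℝ × ℝ) | q.2 ∈ box q.1.1 q.1.2} := by
  simp only [box, Set.mem_prod, Set.mem_Icc, Set.ofPred_and]
  refine ((measurableSet_le ?_ ?_).inter (measurableSet_le ?_ ?_)).inter
    ((measurableSet_le ?_ ?_).inter (measurableSet_le ?_ ?_)) <;> fun_prop

theorem measurableSet_box (x u : ℝ × ℝ) : MeasurableSet (box x u) :=
  measurableSet_Icc.prod measurableSet_Icc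

theorem mem_box_comm {x y u : ℝ × ℝ} : y ∈ box x u ↔ x ∈ box y u := by
  simp only [box, Set.mem_prod, Set.mem_Icc]
  constructor <;> rintro ⟨⟨_, _⟩, _, _⟩ <;> refine ⟨⟨?_, ?_⟩, ?_, ?_⟩ <;> linarith

theorem volume_box (x : ℝ × ℝ) (u : ℝ × ℝ) :
    volume (box x u) = ENNReal.ofReal u.1 * ENNReal.ofReal u.2 := by
  rw [box, Measure.volume_eq_prod, Measure.prod_prod, Real.volume_Icc, Real.volume_Icc]
  ring_nf

theorem measurable_measure_box (m : Measure (ℝ × ℝ)) [IsFiniteMeasure m] :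
    Measurable fun p : (ℝ × ℝ) × (ℝ × ℝ) ↦ m (box p.1 p.2) :=
  measurable_measure_prodMk_left measurableSet_mem_box

/-- Tonelli, with y ∈ B(x,u) iff x ∈ B(y,u): each point y is covered by a set of centres of area
u₁u₂. -/
theorem lintegral_measure_box (m : Measure (ℝ × ℝ)) [IsFiniteMeasure m] (u : ℝ × ℝ) :
    ∫⁻ x, m (box x u) = m Set.univ * (ENNReal.ofReal u.1 * ENNReal.ofReal u.2) := by
  have hS : MeasurableSet {q : (ℝ × ℝ) × (ℝ × ℝ) | q.2 ∈ box q.1 u} :=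
    measurableSet_mem_box.preimage (f := fun q : (ℝ × ℝ) × (ℝ × ℝ) ↦ ((q.1, u), q.2)) (by fun_prop)
  have h1 := Measure.prod_apply (μ := (volume : Measure (ℝ × ℝ))) (ν := m) hS
  have h2 := Measure.prod_apply_symm (μ := (volume : Measure (ℝ × ℝ))) (ν := m) hS
  have h3 : ∀ x, Prod.mk x ⁻¹' {q : (ℝ × ℝ) × (ℝ × ℝ) | q.2 ∈ box q.1 u} = box x u := fun x ↦ rfl
  have h4 : ∀ y, (fun x ↦ (x, y)) ⁻¹' {q : (ℝ × ℝ) × (ℝ × ℝ) | q.2 ∈ box q.1 u} = box y u := by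
    intro y
    ext x
    exact mem_box_comm
  simp only [h3] at h1
  simp only [h4, volume_box, lintegral_const] at h2
  rw [← h1, h2, mul_comm]

theorem measurable_boxMass (μ : SignedMeasure (ℝ × ℝ)) : Measurable (boxMass μ) := by
  have : boxMass μ = fun p ↦ (μ.toJordanDecomposition.posPart (box p.1 p.2)).toReal -
      (μ.toJordanDecomposition.negPart (box p.1 p.2)).toReal := by
    ext p
    conv_lhs => rw [boxMass, ← μ.toSignedMeasure_toJordanDecomposition]
    simp [JordanDecomposition.toSignedMeasure, measurableSet_box, Measure.real,
      Measure.toSignedMeasure_apply]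
  rw [this]
  exact (measurable_measure_box _).ennreal_toReal.sub (measurable_measure_box _).ennreal_toReal

theorem enorm_boxMass_le (μ : SignedMeasure (ℝ × ℝ)) (p : (ℝ × ℝ) × (ℝ × ℝ)) :
    ‖boxMass μ p‖ₑ ≤ μ.totalVariation (box p.1 p.2) :=
  μ.enorm_le_totalVariation _

instance (μ : SignedMeasure (ℝ × ℝ)) : IsFiniteMeasure μ.totalVariation := by
  unfold SignedMeasure.totalVariation; infer_instance

theorem abs_boxMass_le (μ : SignedMeasure (ℝ × ℝ)) (p : (ℝ × ℝ) × (ℝ × ℝ)) :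
    |boxMass μ p| ≤ μ.totalVariation.real Set.univ :=
  (μ.norm_le_totalVariation _).trans (measureReal_mono (Set.subset_univ _))

theorem lintegral_enorm_boxMass_le (μ : SignedMeasure (ℝ × ℝ)) (u : ℝ × ℝ) :
    ∫⁻ x, ‖boxMass μ (x, u)‖ₑ ≤
      μ.totalVariation Set.univ * (ENNReal.ofReal u.1 * ENNReal.ofReal u.2) :=
  (lintegral_mono fun x ↦ enorm_boxMass_le μ (x, u)).trans_eq (lintegral_measure_box _ u)

theorem integrable_boxMass (μ : SignedMeasure (ℝ × ℝ)) (u : ℝ × ℝ) :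
    Integrable fun x ↦ boxMass μ (x, u) :=
  ⟨((measurable_boxMass μ).comp (by fun_prop)).aestronglyMeasurable,
    (lintegral_enorm_boxMass_le μ u).trans_lt (ENNReal.mul_lt_top (measure_lt_top _ _)
      (ENNReal.mul_lt_top ENNReal.ofReal_lt_top ENNReal.ofReal_lt_top))⟩

theorem boxMass_sq_le (μ : SignedMeasure (ℝ × ℝ)) (p : (ℝ × ℝ) × (ℝ × ℝ)) :
    boxMass μ p ^ 2 ≤ μ.totalVariation.real Set.univ * |boxMass μ p| := by
  rw [← sq_abs, sq]
  gcongr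
  exact abs_boxMass_le μ p

theorem integrable_boxMass_sq (μ : SignedMeasure (ℝ × ℝ)) (u : ℝ × ℝ) :
    Integrable fun x ↦ boxMass μ (x, u) ^ 2 := by
  refine ((integrable_boxMass μ u).abs.const_mul (μ.totalVariation.real Set.univ)).mono'
    (((measurable_boxMass μ).comp (by fun_prop)).pow_const 2).aestronglyMeasurable
    (ae_of_all _ fun x ↦ ?_)
  rw [Real.norm_of_nonneg (sq_nonneg _)]
  exact boxMass_sq_le μ (x, u)

theorem boxMass_linearCombination (μ ν : SignedMeasure (ℝ × ℝ)) (a b : ℝ) :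
    boxMass (a • μ + b • ν) = a • boxMass μ + b • boxMass ν := by
  ext p
  simp [boxMass]

/-- This lets two test measures share the smaller of their exponents. The condition β ≥ 1 makes the
minimum equal u for u ≥ 1. -/
theorem min_rpow_le_min_rpow {u α β : ℝ} (hu : 0 < u) (hβ : 1 ≤ β) (h : β ≤ α) :
    min u (u ^ α) ≤ min u (u ^ β) := by
  refine le_min (min_le_left _ _) ?_
  rcases le_total u 1 with h1 | h1
  · exact (min_le_right _ _).trans (Real.rpow_le_rpow_of_exponent_ge hu h1 h)
  · exact (min_le_left _ _).trans (Real.self_le_rpow_of_one_le h1 hβ)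

theorem linearCombination_mem_testMeasures {γ₁ γ₂ : ℝ} (hγ₁ : 1 < γ₁) (hγ₂ : 1 < γ₂)
    {μ ν : SignedMeasure (ℝ × ℝ)} (hμ : μ ∈ testMeasures γ₁ γ₂) (hν : ν ∈ testMeasures γ₁ γ₂)
    (a b : ℝ) : a • μ + b • ν ∈ testMeasures γ₁ γ₂ := by
  obtain ⟨C, α₁, α₂, hC, h1, h1', h2, h2', h⟩ := hμ
  obtain ⟨D, β₁, β₂, hD, k1, k1', k2, k2', k⟩ := hν
  -- The constant comes from (x + y)² ≤ 2x² + 2y²; the added 1 keeps it positive when a = b = 0.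
  refine ⟨2 * a ^ 2 * C + 2 * b ^ 2 * D + 1, min α₁ β₁, min α₂ β₂, by positivity,
    lt_min h1 k1, (min_le_left _ _).trans h1', lt_min h2 k2, (min_le_left _ _).trans h2',
    fun u hu ↦ ?_⟩
  have hu1 : 0 < u.1 := hu.1
  have hu2 : 0 < u.2 := hu.2
  have hC' := h u hu
  have hD' := k u hu
  set w := min u.1 (u.1 ^ min α₁ β₁) * min u.2 (u.2 ^ min α₂ β₂) with hw
  have hw0 : 0 ≤ w := by positivity
  have l1 : min u.1 (u.1 ^ α₁) * min u.2 (u.2 ^ α₂) ≤ w := by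
    have := min_rpow_le_min_rpow hu1 (hγ₁.trans (lt_min h1 k1)).le (min_le_left α₁ β₁)
    have := min_rpow_le_min_rpow hu2 (hγ₂.trans (lt_min h2 k2)).le (min_le_left α₂ β₂)
    rw [hw]
    gcongr
  have l2 : min u.1 (u.1 ^ β₁) * min u.2 (u.2 ^ β₂) ≤ w := by
    have := min_rpow_le_min_rpow hu1 (hγ₁.trans (lt_min h1 k1)).le (min_le_right α₁ β₁)
    have := min_rpow_le_min_rpow hu2 (hγ₂.trans (lt_min h2 k2)).le (min_le_right α₂ β₂)
    rw [hw]
    gcongr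
  rw [mul_assoc] at hC' hD' ⊢
  have i1 := integrable_boxMass_sq μ u
  have i2 := integrable_boxMass_sq ν u
  calc ∫ x, boxMass (a • μ + b • ν) (x, u) ^ 2
      ≤ ∫ x, (2 * a ^ 2 * boxMass μ (x, u) ^ 2 + 2 * b ^ 2 * boxMass ν (x, u) ^ 2) := by
        refine integral_mono (integrable_boxMass_sq _ u)
          ((i1.const_mul _).add (i2.const_mul _)) fun x ↦ ?_
        rw [boxMass_linearCombination]
        simp only [Pi.add_apply, Pi.smul_apply, smul_eq_mul]
        nlinarith [sq_nonneg (a * boxMass μ (x, u) - b * boxMass ν (x, u))]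
    _ = 2 * a ^ 2 * (∫ x, boxMass μ (x, u) ^ 2) + 2 * b ^ 2 * ∫ x, boxMass ν (x, u) ^ 2 := by
        rw [integral_add (i1.const_mul _) (i2.const_mul _), integral_const_mul, integral_const_mul]
    _ ≤ 2 * a ^ 2 * (C * w) + 2 * b ^ 2 * (D * w) := by
        have := hC'.trans (mul_le_mul_of_nonneg_left l1 hC.le)
        have := hD'.trans (mul_le_mul_of_nonneg_left l2 hD.le)
        gcongr
    _ ≤ (2 * a ^ 2 * C + 2 * b ^ 2 * D + 1) * w := by linarith

/-! ### One-dimensional rescaled densities and their weighted L¹ limit. -/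

/-- The Pareto-type density `u ^ (-γ-1)`. -/
noncomputable def powerDensity (γ u : ℝ) : ℝ := 1 / u ^ (γ + 1)

theorem powerDensity_nonneg (γ : ℝ) {u : ℝ} (hu : 0 < u) : 0 ≤ powerDensity γ u := by
  unfold powerDensity; positivity

theorem powerDensity_eq_rpow (γ : ℝ) {u : ℝ} (hu : 0 < u) :
    powerDensity γ u = u ^ (-γ - 1) := by
  rw [powerDensity, one_div, ← Real.rpow_neg hu.le]
  ring_nf

theorem measurable_powerDensity (γ : ℝ) : Measurable (powerDensity γ) := by
  unfold powerDensity; fun_prop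

/-- The density of the rescaled variable, multiplied by `ρ ^ (-γ)`. -/
noncomputable def rescaledDensity (γ : ℝ) (f : ℝ → ℝ) (ρ u : ℝ) : ℝ :=
  ρ ^ (-γ) * (ρ⁻¹ * f (ρ⁻¹ * u))

/-- Near 0 the integrand is at most u^(α-γ-1), integrable as α > γ; near infinity it is at most
u^(-γ), integrable as γ > 1. -/
theorem integrableOn_min_rpow_mul_powerDensity {γ α : ℝ} (hγ : 1 < γ) (hα : γ < α) :
    IntegrableOn (fun u ↦ min u (u ^ α) * powerDensity γ u) (Set.Ioi 0) := by
  have hm : Measurable fun u : ℝ ↦ min u (u ^ α) * powerDensity γ u :=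
    (Measurable.min measurable_id (by fun_prop)).mul (measurable_powerDensity γ)
  rw [← Set.Ioc_union_Ioi_eq_Ioi (zero_le_one' ℝ)]
  refine IntegrableOn.union ?_ ?_
  · have h1 : IntegrableOn (fun u : ℝ ↦ u ^ (α - γ - 1)) (Set.Ioc 0 1) :=
      (intervalIntegrable_iff_integrableOn_Ioc_of_le zero_le_one).1
        (intervalIntegral.intervalIntegrable_rpow' (by linarith))
    refine h1.mono' hm.aestronglyMeasurable ?_
    filter_upwards [ae_restrict_mem measurableSet_Ioc] with u hu
    have hu0 : 0 < u := hu.1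
    rw [Real.norm_of_nonneg (mul_nonneg (by positivity) (powerDensity_nonneg γ hu0)),
      powerDensity_eq_rpow γ hu0]
    calc min u (u ^ α) * u ^ (-γ - 1) ≤ u ^ α * u ^ (-γ - 1) := by gcongr; exact min_le_right _ _
      _ = u ^ (α - γ - 1) := by rw [← Real.rpow_add hu0]; ring_nf
  · have h1 : IntegrableOn (fun u : ℝ ↦ u ^ (-γ)) (Set.Ioi 1) :=
      integrableOn_Ioi_rpow_of_lt (by linarith) one_pos
    refine h1.mono' hm.aestronglyMeasurable ?_
    filter_upwards [ae_restrict_mem measurableSet_Ioi] with u hu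
    have hu0 : 0 < u := one_pos.trans hu
    rw [Real.norm_of_nonneg (mul_nonneg (by positivity) (powerDensity_nonneg γ hu0)),
      powerDensity_eq_rpow γ hu0]
    calc min u (u ^ α) * u ^ (-γ - 1) ≤ u ^ (1 : ℝ) * u ^ (-γ - 1) := by
          rw [Real.rpow_one]; gcongr; exact min_le_left _ _
      _ = u ^ (-γ) := by rw [← Real.rpow_add hu0]; ring_nf

theorem exists_le_powerDensity {γ : ℝ} {f : ℝ → ℝ} (hf : IsEquivalent atTop f (powerDensity γ)) :
    ∃ A > 0, ∀ u, A ≤ u → f u ≤ 2 * powerDensity γ u := by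
  have h1 := hf.isLittleO.bound one_pos
  obtain ⟨A, hA⟩ := eventually_atTop.1 h1
  refine ⟨max A 1, by positivity, fun u hu ↦ ?_⟩
  have h2 := hA u ((le_max_left _ _).trans hu)
  have hu0 : 0 < u := one_pos.trans_le ((le_max_right _ _).trans hu)
  rw [one_mul, Real.norm_of_nonneg (powerDensity_nonneg γ hu0)] at h2
  have := (le_abs_self _).trans h2
  simp only [Pi.sub_apply] at this
  linarith

theorem rescaledDensity_powerDensity (γ : ℝ) {ρ u : ℝ} (hρ : 0 < ρ) (hu : 0 < u) :
    rescaledDensity γ (powerDensity γ) ρ u = powerDensity γ u := by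
  rw [rescaledDensity, powerDensity_eq_rpow γ (by positivity), powerDensity_eq_rpow γ hu,
    Real.mul_rpow (by positivity) hu.le, Real.inv_rpow hρ.le, ← Real.rpow_neg hρ.le,
    ← Real.rpow_neg_one ρ, ← mul_assoc, ← mul_assoc, ← Real.rpow_add hρ, ← Real.rpow_add hρ]
  ring_nf
  simp

/-- The power law is invariant under the rescaling, so the rescaled density is the power law times
the ratio of `f` to it at u/ρ, which tends to 1. -/
theorem tendsto_rescaledDensity {γ : ℝ} {f : ℝ → ℝ} (hf : IsEquivalent atTop f (powerDensity γ))
    {u : ℝ} (hu : 0 < u) :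
    Tendsto (fun ρ ↦ rescaledDensity γ f ρ u) (𝓝[>] 0) (𝓝 (powerDensity γ u)) := by
  have h0 : ∀ᶠ v : ℝ in atTop, powerDensity γ v ≠ 0 := by
    filter_upwards [eventually_gt_atTop 0] with v hv
    unfold powerDensity
    positivity
  have h1 := (isEquivalent_iff_tendsto_one h0).1 hf
  have h2 : Tendsto (fun ρ : ℝ ↦ ρ⁻¹ * u) (𝓝[>] 0) atTop :=
    tendsto_inv_nhdsGT_zero.atTop_mul_const hu
  have h3 := (h1.comp h2).mul_const (powerDensity γ u)
  rw [one_mul] at h3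
  refine h3.congr' ?_
  filter_upwards [self_mem_nhdsWithin] with ρ (hρ : 0 < ρ)
  rw [← rescaledDensity_powerDensity γ hρ hu]
  simp only [rescaledDensity, Function.comp_apply, Pi.div_apply]
  have : powerDensity γ (ρ⁻¹ * u) ≠ 0 := by unfold powerDensity; positivity
  generalize ρ⁻¹ * u = x at this ⊢
  field_simp

section OneDim

variable {γ α : ℝ} {f : ℝ → ℝ}

theorem measurable_rescaledDensity (hfm : Measurable f) (ρ : ℝ) :
    Measurable (rescaledDensity γ f ρ) := by
  unfold rescaledDensity; fun_prop

theorem rescaledDensity_nonneg (hf0 : ∀ u > 0, 0 ≤ f u) {ρ u : ℝ} (hρ : 0 < ρ) (hu : 0 < u) :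
    0 ≤ rescaledDensity γ f ρ u := by
  have := hf0 (ρ⁻¹ * u) (by positivity)
  unfold rescaledDensity
  positivity

theorem integrableOn_rescaledDensity (hfi : IntegrableOn f (Set.Ioi 0)) {ρ : ℝ} (hρ : 0 < ρ) :
    IntegrableOn (rescaledDensity γ f ρ) (Set.Ioi 0) := by
  have h1 := (integrableOn_Ioi_comp_mul_left_iff f 0 (inv_pos.2 hρ)).2 (by rwa [mul_zero])
  exact (h1.const_mul ρ⁻¹).const_mul _

theorem integral_rescaledDensity {ρ : ℝ} (hρ : 0 < ρ) :
    ∫ u in Set.Ioi 0, rescaledDensity γ f ρ u = ρ ^ (-γ) * ∫ u in Set.Ioi 0, f u := by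
  simp only [rescaledDensity]
  rw [integral_const_mul, integral_const_mul, integral_comp_mul_left_Ioi f 0 (inv_pos.2 hρ)]
  simp [hρ.ne']

theorem measurable_min_rpow (α : ℝ) : Measurable fun u : ℝ ↦ min u (u ^ α) :=
  Measurable.min measurable_id (by fun_prop)

theorem rescaledDensity_le {A : ℝ} (hA : ∀ u, A ≤ u → f u ≤ 2 * powerDensity γ u) {ρ u : ℝ}
    (hρ : 0 < ρ) (hu : 0 < u) (hu' : A * ρ ≤ u) :
    rescaledDensity γ f ρ u ≤ 2 * powerDensity γ u := by
  have h1 := hA (ρ⁻¹ * u) (by rw [inv_mul_eq_div, le_div_iff₀ hρ]; exact hu')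
  calc rescaledDensity γ f ρ u ≤ ρ ^ (-γ) * (ρ⁻¹ * (2 * powerDensity γ (ρ⁻¹ * u))) := by
        unfold rescaledDensity; gcongr
    _ = 2 * rescaledDensity γ (powerDensity γ) ρ u := by unfold rescaledDensity; ring
    _ = 2 * powerDensity γ u := by rw [rescaledDensity_powerDensity γ hρ hu]

theorem min_rpow_mul_rescaledDensity_le (hα0 : 0 < α) (hf0 : ∀ u > 0, 0 ≤ f u)
    {A ρ u : ℝ} (hρ : 0 < ρ) (hu : 0 < u) (hu' : u ≤ A * ρ) :
    min u (u ^ α) * rescaledDensity γ f ρ u ≤ (A * ρ) ^ α * rescaledDensity γ f ρ u := by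
  have := rescaledDensity_nonneg (γ := γ) hf0 hρ hu
  gcongr
  exact (min_le_right _ _).trans (by gcongr)

theorem integrableOn_min_rpow_mul_rescaledDensity (hγ : 1 < γ) (hα : γ < α)
    (hfm : Measurable f) (hf0 : ∀ u > 0, 0 ≤ f u) (hfi : IntegrableOn f (Set.Ioi 0))
    (hf : IsEquivalent atTop f (powerDensity γ)) {ρ : ℝ} (hρ : 0 < ρ) :
    IntegrableOn (fun u ↦ min u (u ^ α) * rescaledDensity γ f ρ u) (Set.Ioi 0) := by
  obtain ⟨A, hA0, hA⟩ := exists_le_powerDensity hf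
  refine (((integrableOn_rescaledDensity (γ := γ) hfi hρ).const_mul ((A * ρ) ^ α)).add
    ((integrableOn_min_rpow_mul_powerDensity hγ hα).const_mul 2)).mono'
    ((measurable_min_rpow α).mul (measurable_rescaledDensity hfm ρ)).aestronglyMeasurable ?_
  filter_upwards [ae_restrict_mem measurableSet_Ioi] with u (hu : 0 < u)
  have h1 := rescaledDensity_nonneg (γ := γ) hf0 hρ hu
  have h2 := powerDensity_nonneg γ hu
  have h3 : 0 ≤ min u (u ^ α) := by positivity
  rw [Real.norm_of_nonneg (by positivity)]
  simp only [Pi.add_apply]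
  rcases le_total u (A * ρ) with h | h
  · have := min_rpow_mul_rescaledDensity_le (γ := γ) (by linarith : 0 < α) hf0 hρ hu h
    have : 0 ≤ 2 * (min u (u ^ α) * powerDensity γ u) := by positivity
    linarith
  · have := mul_le_mul_of_nonneg_left (rescaledDensity_le hA hρ hu h) h3
    have : 0 ≤ (A * ρ) ^ α * rescaledDensity γ f ρ u := by positivity
    linarith

/-- The weighted rescaled densities converge in `L¹`. -/
theorem tendsto_integral_abs_rescaledDensity_sub (hγ : 1 < γ) (hα : γ < α)
    (hfm : Measurable f) (hf0 : ∀ u > 0, 0 ≤ f u) (hfi : IntegrableOn f (Set.Ioi 0))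
    (hf : IsEquivalent atTop f (powerDensity γ)) :
    Tendsto (fun ρ ↦ ∫ u in Set.Ioi 0, |min u (u ^ α) * rescaledDensity γ f ρ u -
      min u (u ^ α) * powerDensity γ u|) (𝓝[>] 0) (𝓝 0) := by
  obtain ⟨A, hA0, hA⟩ := exists_le_powerDensity hf
  have hpi := integrableOn_min_rpow_mul_powerDensity hγ hα
  have hpm : Measurable fun u : ℝ ↦ min u (u ^ α) * powerDensity γ u :=
    (measurable_min_rpow α).mul (measurable_powerDensity γ)
  have hrm : ∀ ρ, Measurable fun u : ℝ ↦ min u (u ^ α) * rescaledDensity γ f ρ u := fun ρ ↦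
    (measurable_min_rpow α).mul (measurable_rescaledDensity hfm ρ)
  -- Above Aρ the rescaled density is at most twice the power law, so dominated convergence applies.
  -- Below Aρ no pointwise bound on `f` is available: the power law part is `head`, and the density
  -- part is controlled by total mass.
  set tail : ℝ → ℝ → ℝ := fun ρ ↦ (Set.Ici (A * ρ)).indicator fun u ↦
    |min u (u ^ α) * rescaledDensity γ f ρ u - min u (u ^ α) * powerDensity γ u| with htail
  set head : ℝ → ℝ → ℝ := fun ρ ↦ (Set.Iio (A * ρ)).indicator fun u ↦
    min u (u ^ α) * powerDensity γ u with hhead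
  have htailm : ∀ ρ, Measurable (tail ρ) := fun ρ ↦
    (((hrm ρ).sub hpm).abs).indicator measurableSet_Ici
  have hbound : ∀ ρ > 0, ∀ u > 0, ‖tail ρ u‖ ≤ 3 * (min u (u ^ α) * powerDensity γ u) := by
    intro ρ hρ u hu
    have h1 := rescaledDensity_nonneg (γ := γ) hf0 hρ hu
    have h2 := powerDensity_nonneg γ hu
    have h3 : 0 ≤ min u (u ^ α) := by positivity
    simp only [htail]
    by_cases h : u ∈ Set.Ici (A * ρ)
    · rw [Set.indicator_of_mem h, Real.norm_eq_abs, abs_abs, abs_sub_le_iff]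
      have := mul_le_mul_of_nonneg_left (rescaledDensity_le hA hρ hu h) h3
      have : 0 ≤ min u (u ^ α) * rescaledDensity γ f ρ u := by positivity
      have : 0 ≤ min u (u ^ α) * powerDensity γ u := by positivity
      constructor <;> linarith
    · rw [Set.indicator_of_notMem h, norm_zero]
      positivity
  have ht : Tendsto (fun ρ ↦ ∫ u in Set.Ioi 0, tail ρ u) (𝓝[>] 0) (𝓝 0) := by
    have := tendsto_integral_filter_of_dominated_convergence (μ := volume.restrict (Set.Ioi 0))
      (l := 𝓝[>] (0 : ℝ)) (F := tail) (f := fun _ ↦ (0 : ℝ))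
      (fun u ↦ 3 * (min u (u ^ α) * powerDensity γ u))
      (Eventually.of_forall fun ρ ↦ (htailm ρ).aestronglyMeasurable) ?_ (hpi.const_mul 3) ?_
    · simpa using this
    · filter_upwards [self_mem_nhdsWithin] with ρ (hρ : 0 < ρ)
      filter_upwards [ae_restrict_mem measurableSet_Ioi] with u hu using hbound ρ hρ u hu
    · filter_upwards [ae_restrict_mem measurableSet_Ioi] with u (hu : 0 < u)
      have h1 : Tendsto (fun ρ ↦ |min u (u ^ α) * rescaledDensity γ f ρ u -
          min u (u ^ α) * powerDensity γ u|) (𝓝[>] 0) (𝓝 0) := by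
        have := (((tendsto_rescaledDensity hf hu).const_mul (min u (u ^ α))).sub_const
          (min u (u ^ α) * powerDensity γ u)).abs
        simpa using this
      refine squeeze_zero (fun ρ ↦ Set.indicator_nonneg (fun _ _ ↦ abs_nonneg _) _)
        (fun ρ ↦ ?_) h1
      exact Set.indicator_apply_le' (fun _ ↦ le_rfl) fun _ ↦ abs_nonneg _
  have hh : Tendsto (fun ρ ↦ ∫ u in Set.Ioi 0, head ρ u) (𝓝[>] 0) (𝓝 0) := by
    have := tendsto_integral_filter_of_dominated_convergence (μ := volume.restrict (Set.Ioi 0))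
      (l := 𝓝[>] (0 : ℝ)) (F := head) (f := fun _ ↦ (0 : ℝ))
      (fun u ↦ min u (u ^ α) * powerDensity γ u)
      (Eventually.of_forall fun ρ ↦ (hpm.indicator measurableSet_Iio).aestronglyMeasurable) ?_
      hpi ?_
    · simpa using this
    · refine Eventually.of_forall fun ρ ↦ ?_
      filter_upwards [ae_restrict_mem measurableSet_Ioi] with u (hu : 0 < u)
      have h2 := powerDensity_nonneg γ hu
      have h4 : 0 ≤ min u (u ^ α) * powerDensity γ u := by positivity
      rw [← Real.norm_of_nonneg h4]
      exact norm_indicator_le_norm_self _ _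
    · filter_upwards [ae_restrict_mem measurableSet_Ioi] with u (hu : 0 < u)
      refine tendsto_const_nhds.congr' ?_
      have hc : Tendsto (fun ρ : ℝ ↦ A * ρ) (𝓝[>] 0) (𝓝 0) := by
        have : Continuous fun ρ : ℝ ↦ A * ρ := by fun_prop
        simpa using (this.tendsto 0).mono_left nhdsWithin_le_nhds
      filter_upwards [hc.eventually_lt_const hu] with ρ hρ
      exact (Set.indicator_of_notMem (by simpa using hρ.le) _).symm
  -- For u ≤ Aρ the weight is at most (Aρ)^α, while the rescaled density has total mass ρ^(-γ) ∫ f;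
  -- the product vanishes because α > γ.
  have hs : Tendsto (fun ρ : ℝ ↦ A ^ α * ρ ^ (α - γ) * ∫ u in Set.Ioi 0, f u) (𝓝[>] 0) (𝓝 0) := by
    have h1 : Tendsto (fun ρ : ℝ ↦ ρ ^ (α - γ)) (𝓝[>] 0) (𝓝 0) := by
      have := (Real.continuousAt_rpow_const 0 (α - γ) (Or.inr (by linarith))).tendsto
      rw [Real.zero_rpow (by linarith)] at this
      exact this.mono_left nhdsWithin_le_nhds
    simpa using (h1.const_mul (A ^ α)).mul_const (∫ u in Set.Ioi 0, f u)
  have hsum := (ht.add hh).add hs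
  simp only [add_zero] at hsum
  refine squeeze_zero' (Eventually.of_forall fun ρ ↦ integral_nonneg fun u ↦ abs_nonneg _) ?_ hsum
  filter_upwards [self_mem_nhdsWithin] with ρ (hρ : 0 < ρ)
  have hti : IntegrableOn (tail ρ) (Set.Ioi 0) := by
    refine (hpi.const_mul 3).mono' (htailm ρ).aestronglyMeasurable ?_
    filter_upwards [ae_restrict_mem measurableSet_Ioi] with u hu using hbound ρ hρ u hu
  have hhi : IntegrableOn (head ρ) (Set.Ioi 0) := hpi.indicator measurableSet_Iio
  have hri := (integrableOn_rescaledDensity (γ := γ) hfi hρ).const_mul ((A * ρ) ^ α)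
  have hcomp : A ^ α * ρ ^ (α - γ) * ∫ u in Set.Ioi 0, f u =
      ∫ u in Set.Ioi 0, (A * ρ) ^ α * rescaledDensity γ f ρ u := by
    rw [integral_const_mul, integral_rescaledDensity hρ, Real.mul_rpow hA0.le hρ.le,
      sub_eq_add_neg, Real.rpow_add hρ]
    ring
  have hth : IntegrableOn (fun u ↦ tail ρ u + head ρ u) (Set.Ioi 0) := hti.add hhi
  rw [hcomp, ← integral_add hti hhi, ← integral_add hth hri]
  refine integral_mono_ae (((integrableOn_min_rpow_mul_rescaledDensity hγ hα hfm hf0 hfi hf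
    hρ).sub hpi).abs) (hth.add hri) ?_
  filter_upwards [ae_restrict_mem measurableSet_Ioi] with u (hu : 0 < u)
  have h1 := rescaledDensity_nonneg (γ := γ) hf0 hρ hu
  have h2 := powerDensity_nonneg γ hu
  have h3 : 0 ≤ min u (u ^ α) := by positivity
  have h5 : 0 ≤ min u (u ^ α) * rescaledDensity γ f ρ u := by positivity
  have h6 : 0 ≤ min u (u ^ α) * powerDensity γ u := by positivity
  have h7 : 0 ≤ (A * ρ) ^ α * rescaledDensity γ f ρ u := by positivity
  simp only [htail, hhead]
  rcases lt_or_ge u (A * ρ) with h | h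
  · rw [Set.indicator_of_notMem (by simpa using h), Set.indicator_of_mem (by simpa using h)]
    have := min_rpow_mul_rescaledDensity_le (γ := γ) (by linarith : 0 < α) hf0 hρ hu h.le
    rw [abs_sub_le_iff]
    constructor <;> linarith
  · rw [Set.indicator_of_mem (by simpa using h), Set.indicator_of_notMem (by simpa using h)]
    linarith

end OneDim

/-! ### The edge length measure as a product, and convergence in two dimensions. -/

/-- The measure `f(u) du` on the positive half line. -/
noncomputable def edgeMeasure (f : ℝ → ℝ) : Measure ℝ :=
  (volume.restrict (Set.Ioi 0)).withDensity fun u ↦ ENNReal.ofReal (f u)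

instance (f : ℝ → ℝ) : SFinite (edgeMeasure f) := by
  unfold edgeMeasure; infer_instance

theorem volume_restrict_quadrant : (volume : Measure (ℝ × ℝ)).restrict quadrant =
    (volume.restrict (Set.Ioi 0)).prod (volume.restrict (Set.Ioi 0)) := by
  rw [Measure.prod_restrict]; rfl

theorem measurableSet_quadrant : MeasurableSet quadrant :=
  measurableSet_Ioi.prod measurableSet_Ioi

theorem sizeMeasure_eq_prod {f₁ f₂ : ℝ → ℝ} (hm₁ : Measurable f₁) (hm₂ : Measurable f₂)
    (h₁ : ∀ u > 0, 0 ≤ f₁ u) : sizeMeasure f₁ f₂ = (edgeMeasure f₁).prod (edgeMeasure f₂) := by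
  rw [edgeMeasure, edgeMeasure, prod_withDensity hm₁.ennreal_ofReal hm₂.ennreal_ofReal,
    ← volume_restrict_quadrant, sizeMeasure]
  refine withDensity_congr_ae ?_
  filter_upwards [ae_restrict_mem measurableSet_quadrant] with u hu
  exact ENNReal.ofReal_mul (h₁ _ hu.1)

theorem map_edgeMeasure {f : ℝ → ℝ} (hm : Measurable f) {ρ : ℝ} (hρ : 0 < ρ) :
    (edgeMeasure f).map (fun u ↦ ρ * u) = edgeMeasure fun u ↦ ρ⁻¹ * f (ρ⁻¹ * u) := by
  ext s hs
  have hs' : MeasurableSet ((fun u ↦ ρ * u) ⁻¹' s) := hs.preimage (by fun_prop)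
  rw [Measure.map_apply (by fun_prop) hs, edgeMeasure, edgeMeasure, withDensity_apply _ hs',
    withDensity_apply _ hs, Measure.restrict_restrict hs', Measure.restrict_restrict hs,
    ← lintegral_indicator (hs'.inter measurableSet_Ioi),
    ← lintegral_indicator (hs.inter measurableSet_Ioi)]
  -- Lebesgue measure on the right only is written as |ρ| times its image under u ↦ ρu; this is the
  -- change of variables.
  conv_rhs => rw [← Real.smul_map_volume_mul_left hρ.ne']
  rw [lintegral_smul_measure, lintegral_map (Measurable.indicator (by fun_prop)
    (hs.inter measurableSet_Ioi)) (by fun_prop), smul_eq_mul, ← lintegral_const_mul' _ _ ENNReal.ofReal_ne_top]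
  congr 1 with u
  have hiff : ρ * u ∈ s ∩ Set.Ioi 0 ↔ u ∈ (fun u ↦ ρ * u) ⁻¹' s ∩ Set.Ioi 0 := by
    simp [mul_pos_iff_of_pos_left hρ]
  by_cases h : u ∈ (fun u ↦ ρ * u) ⁻¹' s ∩ Set.Ioi 0
  · rw [Set.indicator_of_mem h, Set.indicator_of_mem (hiff.2 h),
      ← ENNReal.ofReal_mul (abs_nonneg _), abs_of_pos hρ, inv_mul_cancel_left₀ hρ.ne',
      mul_inv_cancel_left₀ hρ.ne']
  · rw [Set.indicator_of_notMem h, Set.indicator_of_notMem (mt hiff.1 h), mul_zero]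

theorem map_sizeMeasure {f₁ f₂ : ℝ → ℝ} (hm₁ : Measurable f₁) (hm₂ : Measurable f₂)
    (h₁ : ∀ u > 0, 0 ≤ f₁ u) {ρ : ℝ} (hρ : 0 < ρ) :
    (sizeMeasure f₁ f₂).map (fun u ↦ ρ • u) =
      sizeMeasure (fun u ↦ ρ⁻¹ * f₁ (ρ⁻¹ * u)) (fun u ↦ ρ⁻¹ * f₂ (ρ⁻¹ * u)) := by
  rw [sizeMeasure_eq_prod hm₁ hm₂ h₁, sizeMeasure_eq_prod (by fun_prop) (by fun_prop) fun u hu ↦ by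
      have := h₁ (ρ⁻¹ * u) (by positivity)
      positivity,
    ← map_edgeMeasure hm₁ hρ, ← map_edgeMeasure hm₂ hρ,
    Measure.map_prod_map _ _ (by fun_prop) (by fun_prop)]
  rfl

theorem integral_sizeMeasure {g₁ g₂ : ℝ → ℝ} (hm₁ : Measurable g₁) (hm₂ : Measurable g₂)
    (h₁ : ∀ u > 0, 0 ≤ g₁ u) (h₂ : ∀ u > 0, 0 ≤ g₂ u) (φ : ℝ × ℝ → ℂ) :
    ∫ u, φ u ∂(sizeMeasure g₁ g₂) = ∫ u in quadrant, (g₁ u.1 * g₂ u.2) • φ u := by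
  rw [sizeMeasure, integral_withDensity_eq_integral_toReal_smul (by fun_prop)
    (ae_of_all _ fun u ↦ ENNReal.ofReal_lt_top)]
  refine setIntegral_congr_fun measurableSet_quadrant fun u hu ↦ ?_
  rw [ENNReal.toReal_ofReal (mul_nonneg (h₁ _ hu.1) (h₂ _ hu.2))]

/-- With dᵢ = aᵢ - bᵢ, a₁a₂ - b₁b₂ = d₁d₂ + d₁b₂ + b₁d₂, and each term has product integrals. -/
theorem tendsto_integral_abs_prod_sub {ι : Type*} {l : Filter ι} {α β : Type*}
    [MeasurableSpace α] [MeasurableSpace β] {ν₁ : Measure α} {ν₂ : Measure β} [SFinite ν₁]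
    [SFinite ν₂] {a₁ : ι → α → ℝ} {a₂ : ι → β → ℝ} {b₁ : α → ℝ} {b₂ : β → ℝ}
    (ha₁ : ∀ᶠ i in l, Integrable (a₁ i) ν₁) (ha₂ : ∀ᶠ i in l, Integrable (a₂ i) ν₂)
    (hb₁ : Integrable b₁ ν₁) (hb₂ : Integrable b₂ ν₂)
    (h₁ : Tendsto (fun i ↦ ∫ x, |a₁ i x - b₁ x| ∂ν₁) l (𝓝 0))
    (h₂ : Tendsto (fun i ↦ ∫ x, |a₂ i x - b₂ x| ∂ν₂) l (𝓝 0)) :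
    Tendsto (fun i ↦ ∫ z, |a₁ i z.1 * a₂ i z.2 - b₁ z.1 * b₂ z.2| ∂(ν₁.prod ν₂)) l (𝓝 0) := by
  have hb : Tendsto (fun i ↦ (∫ x, |a₁ i x - b₁ x| ∂ν₁) * (∫ x, |a₂ i x - b₂ x| ∂ν₂) +
      (∫ x, |a₁ i x - b₁ x| ∂ν₁) * (∫ x, |b₂ x| ∂ν₂) +
      (∫ x, |b₁ x| ∂ν₁) * (∫ x, |a₂ i x - b₂ x| ∂ν₂)) l (𝓝 0) := by
    simpa using ((h₁.mul h₂).add (h₁.mul_const (∫ x, |b₂ x| ∂ν₂))).add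
      (h₂.const_mul (∫ x, |b₁ x| ∂ν₁))
  refine squeeze_zero' (Eventually.of_forall fun i ↦ integral_nonneg fun _ ↦ abs_nonneg _) ?_ hb
  filter_upwards [ha₁, ha₂] with i i₁ i₂
  have d₁ := (i₁.sub hb₁).abs
  have d₂ := (i₂.sub hb₂).abs
  simp only [Pi.sub_apply] at d₁ d₂
  have d₁₂ : Integrable (fun z : α × β ↦ |a₁ i z.1 - b₁ z.1| * |a₂ i z.2 - b₂ z.2| +
      |a₁ i z.1 - b₁ z.1| * |b₂ z.2|) (ν₁.prod ν₂) := (d₁.mul_prod d₂).add (d₁.mul_prod hb₂.abs)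
  rw [← integral_prod_mul, ← integral_prod_mul, ← integral_prod_mul,
    ← integral_add (d₁.mul_prod d₂) (d₁.mul_prod hb₂.abs),
    ← integral_add d₁₂ (hb₁.abs.mul_prod d₂)]
  refine integral_mono (((i₁.mul_prod i₂).sub (hb₁.mul_prod hb₂)).abs)
    (d₁₂.add (hb₁.abs.mul_prod d₂)) fun z ↦ ?_
  simp only [← abs_mul]
  calc |a₁ i z.1 * a₂ i z.2 - b₁ z.1 * b₂ z.2|
      = |(a₁ i z.1 - b₁ z.1) * (a₂ i z.2 - b₂ z.2) + (a₁ i z.1 - b₁ z.1) * b₂ z.2 +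
        b₁ z.1 * (a₂ i z.2 - b₂ z.2)| := by ring_nf
    _ ≤ _ := abs_add_three _ _ _

section Limit

variable {γ₁ γ₂ α₁ α₂ : ℝ} {f₁ f₂ : ℝ → ℝ}

/-- As φ does not depend on ρ and is bounded by K times the weight, the two integrals differ by at
most K times the L¹ distance of the weighted product densities. -/
theorem tendsto_integral_rescaledDensity_smul (hγ₁ : 1 < γ₁) (hα₁ : γ₁ < α₁) (hγ₂ : 1 < γ₂)
    (hα₂ : γ₂ < α₂) (hm₁ : Measurable f₁) (hm₂ : Measurable f₂)
    (h₁ : ∀ u > 0, 0 ≤ f₁ u) (h₂ : ∀ u > 0, 0 ≤ f₂ u)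
    (hi₁ : IntegrableOn f₁ (Set.Ioi 0)) (hi₂ : IntegrableOn f₂ (Set.Ioi 0))
    (hf₁ : IsEquivalent atTop f₁ (powerDensity γ₁)) (hf₂ : IsEquivalent atTop f₂ (powerDensity γ₂))
    {φ : ℝ × ℝ → ℂ} (hφ : Measurable φ) {K : ℝ}
    (hK : ∀ u ∈ quadrant, ‖φ u‖ ≤ K * (min u.1 (u.1 ^ α₁) * min u.2 (u.2 ^ α₂))) :
    Tendsto (fun ρ ↦ ∫ u in quadrant,
        (rescaledDensity γ₁ f₁ ρ u.1 * rescaledDensity γ₂ f₂ ρ u.2) • φ u) (𝓝[>] 0)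
      (𝓝 (∫ u in quadrant, (powerDensity γ₁ u.1 * powerDensity γ₂ u.2) • φ u)) := by
  have hev : ∀ᶠ ρ : ℝ in 𝓝[>] 0, 0 < ρ := self_mem_nhdsWithin
  have hr₁ : ∀ ρ : ℝ, 0 < ρ → _ := fun ρ hρ ↦
    integrableOn_min_rpow_mul_rescaledDensity hγ₁ hα₁ hm₁ h₁ hi₁ hf₁ hρ
  have hr₂ : ∀ ρ : ℝ, 0 < ρ → _ := fun ρ hρ ↦
    integrableOn_min_rpow_mul_rescaledDensity hγ₂ hα₂ hm₂ h₂ hi₂ hf₂ hρ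
  have hp₁ := integrableOn_min_rpow_mul_powerDensity hγ₁ hα₁
  have hp₂ := integrableOn_min_rpow_mul_powerDensity hγ₂ hα₂
  have hlim := tendsto_integral_abs_prod_sub
    (hev.mono hr₁) (hev.mono hr₂) hp₁ hp₂
    (tendsto_integral_abs_rescaledDensity_sub hγ₁ hα₁ hm₁ h₁ hi₁ hf₁)
    (tendsto_integral_abs_rescaledDensity_sub hγ₂ hα₂ hm₂ h₂ hi₂ hf₂)
  rw [← volume_restrict_quadrant] at hlim
  have key : ∀ w₁ w₂ : ℝ → ℝ, Measurable w₁ → Measurable w₂ →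
      IntegrableOn (fun u ↦ min u (u ^ α₁) * w₁ u) (Set.Ioi 0) →
      IntegrableOn (fun u ↦ min u (u ^ α₂) * w₂ u) (Set.Ioi 0) →
      IntegrableOn (fun u : ℝ × ℝ ↦ (w₁ u.1 * w₂ u.2) • φ u) quadrant := by
    intro w₁ w₂ hw₁ hw₂ k₁ k₂
    have := (k₁.mul_prod k₂).abs.const_mul K
    rw [← volume_restrict_quadrant] at this
    refine this.mono' (by fun_prop) ?_
    filter_upwards [ae_restrict_mem measurableSet_quadrant] with u hu
    have hu1 : 0 < u.1 := hu.1
    have hu2 : 0 < u.2 := hu.2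
    rw [norm_smul, Real.norm_eq_abs]
    refine (mul_le_mul_of_nonneg_left (hK u hu) (abs_nonneg _)).trans_eq ?_
    simp only [abs_mul]
    rw [abs_of_pos (show 0 < min u.1 (u.1 ^ α₁) by positivity),
      abs_of_pos (show 0 < min u.2 (u.2 ^ α₂) by positivity)]
    ring
  have hlimK := hlim.const_mul K
  rw [mul_zero] at hlimK
  rw [tendsto_iff_norm_sub_tendsto_zero]
  refine squeeze_zero' (Eventually.of_forall fun ρ ↦ norm_nonneg _) ?_ hlimK
  filter_upwards [hev] with ρ hρ
  rw [← integral_sub (key _ _ (measurable_rescaledDensity hm₁ ρ) (measurable_rescaledDensity hm₂ ρ)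
    (hr₁ ρ hρ) (hr₂ ρ hρ)) (key _ _ (measurable_powerDensity γ₁) (measurable_powerDensity γ₂)
    hp₁ hp₂), ← integral_const_mul]
  have hint := (((hr₁ ρ hρ).mul_prod (hr₂ ρ hρ)).sub (hp₁.mul_prod hp₂)).abs.const_mul K
  rw [← volume_restrict_quadrant] at hint
  refine norm_integral_le_of_norm_le hint ?_
  filter_upwards [ae_restrict_mem measurableSet_quadrant] with u hu
  have hu1 : 0 < u.1 := hu.1
  have hu2 : 0 < u.2 := hu.2
  rw [← sub_smul, norm_smul, Real.norm_eq_abs]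
  refine (mul_le_mul_of_nonneg_left (hK u hu) (abs_nonneg _)).trans_eq ?_
  rw [mul_left_comm]
  congr 1
  have hw : 0 < min u.1 (u.1 ^ α₁) * min u.2 (u.2 ^ α₂) := by positivity
  conv_lhs => rw [← abs_of_pos hw, ← abs_mul]
  ring_nf

end Limit

/-! ### The intensities: integrability of box masses and convergence of exponents. -/

section Intensity

theorem sigmaFinite_sizeMeasure (g₁ g₂ : ℝ → ℝ) : SigmaFinite (sizeMeasure g₁ g₂) := by
  unfold sizeMeasure ENNReal.ofReal
  infer_instance

instance (γ₁ γ₂ : ℝ) : SigmaFinite (limitIntensity γ₁ γ₂) := by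
  have := sigmaFinite_sizeMeasure (fun u ↦ 1 / u ^ (γ₁ + 1)) (fun u ↦ 1 / u ^ (γ₂ + 1))
  unfold limitIntensity
  infer_instance

theorem scaledIntensity_eq {f₁ f₂ : ℝ → ℝ} (hm₁ : Measurable f₁) (hm₂ : Measurable f₂)
    (h₁ : ∀ u > 0, 0 ≤ f₁ u) {ρ : ℝ} (hρ : 0 < ρ) (l : ℝ) :
    scaledIntensity f₁ f₂ l ρ = ENNReal.ofReal l • (volume : Measure (ℝ × ℝ)).prod
      (sizeMeasure (fun u ↦ ρ⁻¹ * f₁ (ρ⁻¹ * u)) (fun u ↦ ρ⁻¹ * f₂ (ρ⁻¹ * u))) := by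
  rw [scaledIntensity, map_sizeMeasure hm₁ hm₂ h₁ hρ]

theorem sigmaFinite_scaledIntensity {f₁ f₂ : ℝ → ℝ} (hm₁ : Measurable f₁) (hm₂ : Measurable f₂)
    (h₁ : ∀ u > 0, 0 ≤ f₁ u) {ρ : ℝ} (hρ : 0 < ρ) (l : ℝ) :
    SigmaFinite (scaledIntensity f₁ f₂ l ρ) := by
  have := sigmaFinite_sizeMeasure (fun u ↦ ρ⁻¹ * f₁ (ρ⁻¹ * u)) (fun u ↦ ρ⁻¹ * f₂ (ρ⁻¹ * u))
  rw [scaledIntensity_eq hm₁ hm₂ h₁ hρ, ← withDensity_const]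
  exact SigmaFinite.withDensity fun _ ↦ l.toNNReal

theorem measure_edgeMeasure_univ (f : ℝ → ℝ) :
    edgeMeasure f Set.univ = ∫⁻ u in Set.Ioi 0, ENNReal.ofReal (f u) := by
  rw [edgeMeasure, withDensity_apply _ MeasurableSet.univ, Measure.restrict_univ]

theorem integrableOn_of_edgeMeasure_ne_top {f : ℝ → ℝ} (hm : Measurable f)
    (h0 : ∀ u > 0, 0 ≤ f u) (h : edgeMeasure f Set.univ ≠ ∞) : IntegrableOn f (Set.Ioi 0) := by
  refine ⟨hm.aestronglyMeasurable, ?_⟩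
  rw [measure_edgeMeasure_univ] at h
  rw [hasFiniteIntegral_iff_ofReal]
  · exact h.lt_top
  · filter_upwards [ae_restrict_mem measurableSet_Ioi] with u hu using h0 u hu

/-- The two marginal masses multiply to 1, so neither is 0 and hence neither is infinite. -/
theorem integrableOn_of_isProbabilityMeasure {f₁ f₂ : ℝ → ℝ} (hm₁ : Measurable f₁)
    (hm₂ : Measurable f₂) (h₁ : ∀ u > 0, 0 ≤ f₁ u) (h₂ : ∀ u > 0, 0 ≤ f₂ u)
    (hF : IsProbabilityMeasure (sizeMeasure f₁ f₂)) :
    IntegrableOn f₁ (Set.Ioi 0) ∧ IntegrableOn f₂ (Set.Ioi 0) := by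
  have h : edgeMeasure f₁ Set.univ * edgeMeasure f₂ Set.univ = 1 := by
    rw [← Measure.prod_prod, Set.univ_prod_univ, ← sizeMeasure_eq_prod hm₁ hm₂ h₁]
    exact hF.measure_univ
  have hne₁ : edgeMeasure f₁ Set.univ ≠ 0 := by
    intro h0
    simp [h0] at h
  have hne₂ : edgeMeasure f₂ Set.univ ≠ 0 := by
    intro h0
    simp [h0] at h
  constructor
  · refine integrableOn_of_edgeMeasure_ne_top hm₁ h₁ fun ht ↦ ?_
    rw [ht, ENNReal.top_mul hne₂] at h
    simp at h
  · refine integrableOn_of_edgeMeasure_ne_top hm₂ h₂ fun ht ↦ ?_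
    rw [ht, ENNReal.mul_top hne₁] at h
    simp at h

theorem integrable_edgeMeasure_iff {f g : ℝ → ℝ} (hm : Measurable f) (h0 : ∀ u > 0, 0 ≤ f u) :
    Integrable g (edgeMeasure f) ↔ IntegrableOn (fun u ↦ g u * f u) (Set.Ioi 0) := by
  rw [edgeMeasure, integrable_withDensity_iff hm.ennreal_ofReal
    (ae_of_all _ fun u ↦ ENNReal.ofReal_lt_top)]
  refine integrable_congr ?_
  filter_upwards [ae_restrict_mem measurableSet_Ioi] with u hu
  rw [ENNReal.toReal_ofReal (h0 u hu)]

theorem integrable_id_edgeMeasure {γ : ℝ} {f : ℝ → ℝ} (hγ : 1 < γ) (hm : Measurable f)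
    (h0 : ∀ u > 0, 0 ≤ f u) (hi : IntegrableOn f (Set.Ioi 0))
    (hf : IsEquivalent atTop f (powerDensity γ)) : Integrable (fun u ↦ u) (edgeMeasure f) := by
  rw [integrable_edgeMeasure_iff hm h0]
  have h1 := integrableOn_min_rpow_mul_rescaledDensity hγ (lt_add_one γ) hm h0 hi hf one_pos
  refine (h1.add hi).mono' (measurable_id.mul hm).aestronglyMeasurable ?_
  filter_upwards [ae_restrict_mem measurableSet_Ioi] with u (hu : 0 < u)
  have hfu := h0 u hu
  rw [Real.norm_of_nonneg (by positivity)]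
  simp only [Pi.add_apply, rescaledDensity, Real.one_rpow, inv_one, one_mul]
  rcases le_total u 1 with h | h
  · have : 0 ≤ min u (u ^ (γ + 1)) * f u := by positivity
    nlinarith
  · rw [min_eq_left (Real.self_le_rpow_of_one_le h (by linarith))]
    linarith

/-- Integrating over centres leaves at most the total variation times u₁u₂, which is integrable
because tails with γᵢ > 1 have finite mean. -/
theorem integrable_boxMass_scaledIntensity {γ₁ γ₂ : ℝ} {f₁ f₂ : ℝ → ℝ} (hγ₁ : 1 < γ₁)
    (hγ₂ : 1 < γ₂) (hm₁ : Measurable f₁) (hm₂ : Measurable f₂)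
    (h₁ : ∀ u > 0, 0 ≤ f₁ u) (h₂ : ∀ u > 0, 0 ≤ f₂ u)
    (hi₁ : IntegrableOn f₁ (Set.Ioi 0)) (hi₂ : IntegrableOn f₂ (Set.Ioi 0))
    (hf₁ : IsEquivalent atTop f₁ (powerDensity γ₁)) (hf₂ : IsEquivalent atTop f₂ (powerDensity γ₂))
    (l ρ : ℝ) (μ : SignedMeasure (ℝ × ℝ)) :
    Integrable (boxMass μ) (scaledIntensity f₁ f₂ l ρ) := by
  refine Integrable.smul_measure ?_ ENNReal.ofReal_ne_top
  refine ⟨(measurable_boxMass μ).aestronglyMeasurable, ?_⟩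
  have hfin : Integrable (fun u : ℝ × ℝ ↦ u.1 * u.2) (sizeMeasure f₁ f₂) := by
    rw [sizeMeasure_eq_prod hm₁ hm₂ h₁]
    exact (integrable_id_edgeMeasure hγ₁ hm₁ h₁ hi₁ hf₁).mul_prod
      (integrable_id_edgeMeasure hγ₂ hm₂ h₂ hi₂ hf₂)
  have hmap : ∫⁻ u, ENNReal.ofReal u.1 * ENNReal.ofReal u.2
      ∂((sizeMeasure f₁ f₂).map fun u ↦ ρ • u) < ∞ := by
    rw [lintegral_map (by fun_prop) (by fun_prop)]
    have hfin' := (hfin.const_mul (ρ * ρ)).2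
    refine (lintegral_mono fun u ↦ ?_).trans_lt hfin'
    calc ENNReal.ofReal (ρ • u).1 * ENNReal.ofReal (ρ • u).2
        ≤ ‖(ρ • u).1‖ₑ * ‖(ρ • u).2‖ₑ :=
          mul_le_mul' (Real.ofReal_le_enorm _) (Real.ofReal_le_enorm _)
      _ = ‖ρ * ρ * (u.1 * u.2)‖ₑ := by
          rw [← enorm_mul, Prod.smul_fst, Prod.smul_snd, smul_eq_mul, smul_eq_mul]
          ring_nf
  have hm := (measurable_boxMass μ).enorm
  rw [HasFiniteIntegral, lintegral_prod_symm _ hm.aemeasurable]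
  refine (lintegral_mono fun u ↦ lintegral_enorm_boxMass_le μ u).trans_lt ?_
  rw [lintegral_const_mul _ (by fun_prop)]
  exact ENNReal.mul_lt_top (measure_lt_top _ _) hmap

/-- The bound defining a test measure is a product of weights, each integrable against its power
law. -/
theorem integrable_boxMass_sq_limitIntensity {γ₁ γ₂ : ℝ} (hγ₁ : 1 < γ₁) (hγ₂ : 1 < γ₂)
    {μ : SignedMeasure (ℝ × ℝ)} (hμ : μ ∈ testMeasures γ₁ γ₂) :
    Integrable (fun p ↦ boxMass μ p ^ 2) (limitIntensity γ₁ γ₂) := by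
  obtain ⟨C, α₁, α₂, hC, h1, -, h2, -, h⟩ := hμ
  have hm := ((measurable_boxMass μ).pow_const 2)
  rw [limitIntensity, integrable_prod_iff' hm.aestronglyMeasurable]
  refine ⟨ae_of_all _ fun u ↦ integrable_boxMass_sq μ u, ?_⟩
  have hb : Integrable (fun u : ℝ × ℝ ↦ min u.1 (u.1 ^ α₁) * min u.2 (u.2 ^ α₂))
      (sizeMeasure (powerDensity γ₁) (powerDensity γ₂)) := by
    rw [sizeMeasure_eq_prod (measurable_powerDensity γ₁) (measurable_powerDensity γ₂)
      fun u hu ↦ powerDensity_nonneg γ₁ hu]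
    refine Integrable.mul_prod (f := fun u : ℝ ↦ min u (u ^ α₁)) (g := fun u : ℝ ↦ min u (u ^ α₂))
      ?_ ?_
    · rw [integrable_edgeMeasure_iff (measurable_powerDensity γ₁)
        fun u hu ↦ powerDensity_nonneg γ₁ hu]
      exact integrableOn_min_rpow_mul_powerDensity hγ₁ h1
    · rw [integrable_edgeMeasure_iff (measurable_powerDensity γ₂)
        fun u hu ↦ powerDensity_nonneg γ₂ hu]
      exact integrableOn_min_rpow_mul_powerDensity hγ₂ h2
  refine (hb.const_mul C).mono' ?_ ?_
  · exact (StronglyMeasurable.integral_prod_left'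
      (f := fun p : (ℝ × ℝ) × (ℝ × ℝ) ↦ ‖boxMass μ p ^ 2‖)
      hm.norm.stronglyMeasurable).aestronglyMeasurable
  · have hq : ∀ᵐ u ∂(sizeMeasure (powerDensity γ₁) (powerDensity γ₂)), u ∈ quadrant :=
      (withDensity_absolutelyContinuous _ _).ae_le (ae_restrict_mem measurableSet_quadrant)
    filter_upwards [hq] with u hu
    rw [Real.norm_of_nonneg (integral_nonneg fun _ ↦ norm_nonneg _), ← mul_assoc]
    refine le_trans (le_of_eq ?_) (h u hu)
    congr 1 with x
    exact Real.norm_of_nonneg (sq_nonneg _)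

theorem memLp_boxMass_limitIntensity {γ₁ γ₂ : ℝ} (hγ₁ : 1 < γ₁) (hγ₂ : 1 < γ₂)
    {μ : SignedMeasure (ℝ × ℝ)} (hμ : μ ∈ testMeasures γ₁ γ₂) :
    MemLp (boxMass μ) 2 (limitIntensity γ₁ γ₂) :=
  (memLp_two_iff_integrable_sq (measurable_boxMass μ).aestronglyMeasurable).2
    (integrable_boxMass_sq_limitIntensity hγ₁ hγ₂ hμ)

theorem integrable_jumpExponent_boxMass {μ : SignedMeasure (ℝ × ℝ)}
    {n : Measure ((ℝ × ℝ) × (ℝ × ℝ))} (h : Integrable (fun p ↦ boxMass μ p ^ 2) n) :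
    Integrable (fun p ↦ jumpExponent (boxMass μ p)) n :=
  (h.const_mul 2).mono' (continuous_jumpExponent.measurable.comp
    (measurable_boxMass μ)).aestronglyMeasurable (ae_of_all _ fun _ ↦ norm_jumpExponent_le _)

/-- The Lévy–Khinchine exponents of the rescaled intensities converge. -/
theorem tendsto_integral_jumpExponent {γ₁ γ₂ : ℝ} {f₁ f₂ : ℝ → ℝ} (hγ₁ : 1 < γ₁)
    (hγ₂ : 1 < γ₂) (hm₁ : Measurable f₁) (hm₂ : Measurable f₂)
    (h₁ : ∀ u > 0, 0 ≤ f₁ u) (h₂ : ∀ u > 0, 0 ≤ f₂ u)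
    (hi₁ : IntegrableOn f₁ (Set.Ioi 0)) (hi₂ : IntegrableOn f₂ (Set.Ioi 0))
    (hf₁ : IsEquivalent atTop f₁ (powerDensity γ₁)) (hf₂ : IsEquivalent atTop f₂ (powerDensity γ₂))
    {lam : ℝ → ℝ} (hlam_pos : ∀ ρ > 0, 0 < lam ρ)
    (hlam : Tendsto (fun ρ ↦ lam ρ * ρ ^ (γ₁ + γ₂)) (𝓝[>] 0) (𝓝 1))
    {μ : SignedMeasure (ℝ × ℝ)} (hμ : μ ∈ testMeasures γ₁ γ₂) :
    Tendsto (fun ρ ↦ ∫ p, jumpExponent (boxMass μ p) ∂(scaledIntensity f₁ f₂ (lam ρ) ρ))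
      (𝓝[>] 0) (𝓝 (∫ p, jumpExponent (boxMass μ p) ∂(limitIntensity γ₁ γ₂))) := by
  have hl := integrable_jumpExponent_boxMass (integrable_boxMass_sq_limitIntensity hγ₁ hγ₂ hμ)
  obtain ⟨C, α₁, α₂, hC, hα₁, -, hα₂, -, h⟩ := hμ
  set φ : ℝ × ℝ → ℂ := fun u ↦ ∫ x, jumpExponent (boxMass μ (x, u)) with hφ
  have hφm : Measurable φ :=
    (StronglyMeasurable.integral_prod_left'
      (f := fun p : (ℝ × ℝ) × (ℝ × ℝ) ↦ jumpExponent (boxMass μ p))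
      (continuous_jumpExponent.measurable.comp
        (measurable_boxMass μ)).stronglyMeasurable).measurable
  have hφb : ∀ u ∈ quadrant, ‖φ u‖ ≤ 2 * C * (min u.1 (u.1 ^ α₁) * min u.2 (u.2 ^ α₂)) := by
    intro u hu
    calc ‖φ u‖ ≤ ∫ x, 2 * boxMass μ (x, u) ^ 2 :=
          norm_integral_le_of_norm_le ((integrable_boxMass_sq μ u).const_mul 2)
            (ae_of_all _ fun x ↦ norm_jumpExponent_le _)
      _ ≤ 2 * (C * min u.1 (u.1 ^ α₁) * min u.2 (u.2 ^ α₂)) := by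
          rw [integral_const_mul]
          exact mul_le_mul_of_nonneg_left (h u hu) zero_le_two
      _ = _ := by ring
  have hmain := tendsto_integral_rescaledDensity_smul hγ₁ hα₁ hγ₂ hα₂ hm₁ hm₂ h₁ h₂ hi₁ hi₂
    hf₁ hf₂ hφm hφb
  have hlim : ∫ p, jumpExponent (boxMass μ p) ∂(limitIntensity γ₁ γ₂) =
      ∫ u in quadrant, (powerDensity γ₁ u.1 * powerDensity γ₂ u.2) • φ u := by
    rw [limitIntensity] at hl ⊢
    rw [integral_prod_symm _ hl]
    exact integral_sizeMeasure (measurable_powerDensity γ₁) (measurable_powerDensity γ₂)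
      (fun u hu ↦ powerDensity_nonneg γ₁ hu) (fun u hu ↦ powerDensity_nonneg γ₂ hu) φ
  rw [hlim]
  have := hlam.smul hmain
  rw [one_smul] at this
  refine this.congr' ?_
  filter_upwards [self_mem_nhdsWithin] with ρ (hρ : 0 < ρ)
  -- Fubini is justified at intensity factor 1, since the factor λ comes out as a scalar. Square
  -- integrability follows from integrability because box masses are bounded.
  have hsc := integrable_boxMass_scaledIntensity hγ₁ hγ₂ hm₁ hm₂ h₁ h₂ hi₁ hi₂ hf₁ hf₂ 1 ρ μ
  have hsq : Integrable (fun p ↦ boxMass μ p ^ 2) (scaledIntensity f₁ f₂ 1 ρ) := by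
    refine (hsc.abs.const_mul (μ.totalVariation.real Set.univ)).mono'
      ((measurable_boxMass μ).pow_const 2).aestronglyMeasurable (ae_of_all _ fun p ↦ ?_)
    rw [Real.norm_of_nonneg (sq_nonneg _)]
    exact boxMass_sq_le μ p
  have hj := integrable_jumpExponent_boxMass hsq
  rw [scaledIntensity_eq hm₁ hm₂ h₁ hρ, ENNReal.ofReal_one, one_smul] at hj
  rw [scaledIntensity_eq hm₁ hm₂ h₁ hρ, integral_smul_measure, integral_prod_symm _ hj,
    ENNReal.toReal_ofReal (hlam_pos ρ hρ).le]
  have hpos : ∀ f : ℝ → ℝ, (∀ u > 0, 0 ≤ f u) → ∀ u > 0, 0 ≤ ρ⁻¹ * f (ρ⁻¹ * u) := by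
    intro f hf u hu
    have := hf (ρ⁻¹ * u) (by positivity)
    positivity
  rw [integral_sizeMeasure (by fun_prop) (by fun_prop) (hpos f₁ h₁) (hpos f₂ h₂), mul_smul,
    ← integral_smul (ρ ^ (γ₁ + γ₂))]
  congr 1
  congr 1 with u
  rw [smul_smul]
  congr 1
  simp only [rescaledDensity]
  -- The factor ρ^(γ₁+γ₂) paired with λ cancels the normalisations of the two rescaled densities.
  have e1 : ρ ^ (γ₁ + γ₂) * (ρ ^ (-γ₁) * ρ ^ (-γ₂)) = 1 := by
    rw [← Real.rpow_add hρ, ← Real.rpow_add hρ]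
    ring_nf
    simp
  linear_combination (ρ⁻¹ * f₁ (ρ⁻¹ * u.1) * (ρ⁻¹ * f₂ (ρ⁻¹ * u.2))) * e1

end Intensity

/-! ### Finite linear combinations and the Cramér–Wold device. -/

theorem zero_mem_testMeasures {γ₁ γ₂ : ℝ} (hγ₁ : γ₁ < 2) (hγ₂ : γ₂ < 2) :
    (0 : SignedMeasure (ℝ × ℝ)) ∈ testMeasures γ₁ γ₂ := by
  refine ⟨1, 2, 2, one_pos, hγ₁, le_rfl, hγ₂, le_rfl, fun u hu ↦ ?_⟩
  have hu1 : 0 < u.1 := hu.1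
  have hu2 : 0 < u.2 := hu.2
  simp only [boxMass, FunLike.coe_zero, Pi.zero_apply, ne_eq, OfNat.ofNat_ne_zero,
    not_false_eq_true, zero_pow, integral_zero]
  positivity

section Linear

variable {Ω V : Type*} [MeasurableSpace Ω] [AddCommGroup V] [Module ℝ V]

/-- A random field which is almost surely linear on a set closed under linear combinations is
almost surely compatible with finite linear combinations. -/
theorem sum_smul_mem_and_ae_eq {P : Measure Ω} {S : Set V} {J : V → Ω → ℝ} (h0 : (0 : V) ∈ S)
    (hS : ∀ μ ∈ S, ∀ ν ∈ S, ∀ a b : ℝ, a • μ + b • ν ∈ S)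
    (hJ : ∀ μ ∈ S, ∀ ν ∈ S, ∀ a b : ℝ, J (a • μ + b • ν) =ᵐ[P] a • J μ + b • J ν)
    {ι : Type*} (s : Finset ι) (t : ι → ℝ) {μ : ι → V} (hμ : ∀ i, μ i ∈ S) :
    ∑ i ∈ s, t i • μ i ∈ S ∧
      J (∑ i ∈ s, t i • μ i) =ᵐ[P] fun ω ↦ ∑ i ∈ s, t i * J (μ i) ω := by
  classical
  induction s using Finset.induction_on with
  | empty =>
    -- Linearity with both coefficients 0 forces the field to vanish almost surely at 0.
    have := hJ 0 h0 0 h0 0 0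
    simp only [zero_smul, add_zero] at this
    simpa using! ⟨h0, this⟩
  | insert i s his ih =>
    have hm := hS _ (hμ i) _ ih.1 (t i) 1
    have he := hJ _ (hμ i) _ ih.1 (t i) 1
    rw [one_smul] at hm he
    rw [Finset.sum_insert his]
    refine ⟨hm, ?_⟩
    filter_upwards [he, ih.2] with ω h1 h2
    rw [h1, Finset.sum_insert his, Pi.add_apply, Pi.smul_apply, one_smul, h2, smul_eq_mul]

end Linear

theorem aemeasurable_toLp {Ω : Type*} [MeasurableSpace Ω] {P : Measure Ω} {m : ℕ}
    {Z : Ω → Fin m → ℝ} (hZ : AEMeasurable Z P) :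
    AEMeasurable (fun ω ↦ (WithLp.toLp 2 (Z ω) : EuclideanSpace ℝ (Fin m))) P :=
  Measurable.comp_aemeasurable (g := (WithLp.toLp 2 : (Fin m → ℝ) → EuclideanSpace ℝ (Fin m)))
    (by fun_prop) hZ

theorem charFun_map_toLp {Ω : Type*} [MeasurableSpace Ω] {P : Measure Ω} {m : ℕ}
    {Z : Ω → Fin m → ℝ} (hZ : AEMeasurable Z P) (t : EuclideanSpace ℝ (Fin m)) :
    charFun (P.map fun ω ↦ (WithLp.toLp 2 (Z ω) : EuclideanSpace ℝ (Fin m))) t =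
      ∫ ω, Complex.exp ((∑ k, t k * Z ω k : ℝ) * Complex.I) ∂P := by
  rw [charFun_apply, integral_map (aemeasurable_toLp hZ) (by fun_prop)]
  simp [PiLp.inner_apply]

/-- The Cramér–Wold device in terms of characteristic functions, along a countably generated
filter. -/
theorem tendstoInDistribution_of_tendsto_integral_cexp {ι : Type*} {l : Filter ι}
    [l.IsCountablyGenerated] {Ω : ι → Type*} {Ω' : Type*} [∀ i, MeasurableSpace (Ω i)]
    [MeasurableSpace Ω'] {P : ∀ i, Measure (Ω i)} [∀ i, IsProbabilityMeasure (P i)]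
    {P' : Measure Ω'} [IsProbabilityMeasure P'] {m : ℕ} {X : ∀ i, Ω i → Fin m → ℝ}
    {Y : Ω' → Fin m → ℝ} (hX : ∀ i, AEMeasurable (X i) (P i)) (hY : AEMeasurable Y P')
    (h : ∀ t : Fin m → ℝ, Tendsto
      (fun i ↦ ∫ ω, Complex.exp ((∑ k, t k * X i ω k : ℝ) * Complex.I) ∂(P i)) l
      (𝓝 (∫ ω, Complex.exp ((∑ k, t k * Y ω k : ℝ) * Complex.I) ∂P'))) :
    TendstoInDistribution X l Y P P' := by
  have hE : TendstoInDistribution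
      (fun i ω ↦ (WithLp.toLp 2 (X i ω) : EuclideanSpace ℝ (Fin m))) l
      (fun ω ↦ WithLp.toLp 2 (Y ω)) P P' := by
    -- Lévy's continuity theorem is applied along sequences, which suffice for a countably generated
    -- filter. The Euclidean structure supplies the inner product in the characteristic function.
    refine ⟨fun i ↦ aemeasurable_toLp (hX i), aemeasurable_toLp hY, tendsto_of_seq_tendsto fun s hs ↦ ?_⟩
    refine ProbabilityMeasure.tendsto_of_tendsto_charFun fun t ↦ ?_
    rw [ProbabilityMeasure.coe_mk, charFun_map_toLp hY]
    exact ((h t).comp hs).congr fun k ↦ (charFun_map_toLp (hX (s k)) t).symm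
  exact hE.continuous_comp (g := WithLp.ofLp) (by fun_prop)

section Fields

variable {Ω : Type*} [MeasurableSpace Ω] {P : Measure Ω}
  {N : Ω → Measure ((ℝ × ℝ) × (ℝ × ℝ))} {n : Measure ((ℝ × ℝ) × (ℝ × ℝ))} [SigmaFinite n]

/-- By Campbell's formula the expectation of the field is its integral against the intensity, so
centring is compensation. -/
theorem centredField_eq_centredIntegral (h : IsPoissonRandomMeasure P N n)
    {μ : SignedMeasure (ℝ × ℝ)} (hi : Integrable (boxMass μ) n) :
    centredField P N μ = centredIntegral N n (boxMass μ) := by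
  ext ω
  rw [centredField, centredIntegral]
  simp only [field]
  rw [h.integral_integral (measurable_boxMass μ) hi]

end Fields

end RandomBoxes

/-! ### The intermediate intensity regime. -/

theorem mainTheorem2
    (γ₁ γ₂ : ℝ) (hγ₁ : γ₁ ∈ Set.Ioo (1 : ℝ) 2) (hγ₂ : γ₂ ∈ Set.Ioo (1 : ℝ) 2)
    -- the edge length densities
    (f₁ f₂ : ℝ → ℝ) (hf₁m : Measurable f₁) (hf₂m : Measurable f₂)
    (hf₁nonneg : ∀ u > 0, 0 ≤ f₁ u) (hf₂nonneg : ∀ u > 0, 0 ≤ f₂ u)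
    (hf₁ : IsEquivalent atTop f₁ (fun u ↦ 1 / u ^ (γ₁ + 1)))
    (hf₂ : IsEquivalent atTop f₂ (fun u ↦ 1 / u ^ (γ₂ + 1)))
    (hF : IsProbabilityMeasure (RandomBoxes.sizeMeasure f₁ f₂))
    -- the intensity as a function of the scaling parameter
    (lam : ℝ → ℝ) (hlam_pos : ∀ ρ > 0, 0 < lam ρ)
    (hlam : Tendsto lam (𝓝[>] 0) atTop)
    (hlam_scale : Tendsto (fun ρ ↦ lam ρ * ρ ^ (γ₁ + γ₂)) (𝓝[>] 0) (𝓝 1))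
    -- the Poisson random measures of the model, for each positive scaling parameter
    (Ω : Set.Ioi (0 : ℝ) → Type*) [∀ ρ, MeasurableSpace (Ω ρ)]
    (P : ∀ ρ, Measure (Ω ρ)) [∀ ρ, IsProbabilityMeasure (P ρ)]
    (N : ∀ ρ, Ω ρ → Measure ((ℝ × ℝ) × (ℝ × ℝ)))
    (hN : ∀ ρ : Set.Ioi (0 : ℝ), RandomBoxes.IsPoissonRandomMeasure (P ρ) (N ρ)
      (RandomBoxes.scaledIntensity f₁ f₂ (lam ρ) ρ))
    -- the Poisson random measure of the limit
    (Ω' : Type*) [MeasurableSpace Ω'] (P' : Measure Ω') [IsProbabilityMeasure P']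
    (N' : Ω' → Measure ((ℝ × ℝ) × (ℝ × ℝ)))
    (hN' : RandomBoxes.IsPoissonRandomMeasure P' N' (RandomBoxes.limitIntensity γ₁ γ₂)) :
    -- the fields of the model are well defined
    (∀ (ρ : Set.Ioi (0 : ℝ)) (μ : SignedMeasure (ℝ × ℝ)),
      (∀ᵐ ω ∂(P ρ), Integrable (RandomBoxes.boxMass μ) (N ρ ω)) ∧
        Integrable (RandomBoxes.field (N ρ) μ) (P ρ)) ∧
    -- the limit is a well-defined linear random field of compensated Poisson integrals
    (∀ μ ∈ RandomBoxes.testMeasures γ₁ γ₂,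
      RandomBoxes.IsCompensatedIntegral P' N' (RandomBoxes.limitIntensity γ₁ γ₂)
        (RandomBoxes.boxMass μ) (RandomBoxes.limitField γ₁ γ₂ P' N' μ)) ∧
    (∀ μ ∈ RandomBoxes.testMeasures γ₁ γ₂, ∀ ν ∈ RandomBoxes.testMeasures γ₁ γ₂, ∀ a b : ℝ,
      RandomBoxes.limitField γ₁ γ₂ P' N' (a • μ + b • ν) =ᵐ[P']
        a • RandomBoxes.limitField γ₁ γ₂ P' N' μ + b • RandomBoxes.limitField γ₁ γ₂ P' N' ν) ∧
    -- convergence of the finite-dimensional distributions as `ρ ↓ 0`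
    RandomBoxes.TendstoFDD
      (fun (ρ : Set.Ioi (0 : ℝ)) (μ : RandomBoxes.testMeasures γ₁ γ₂) ↦
        RandomBoxes.centredField (P ρ) (N ρ) μ)
      (comap Subtype.val (𝓝[>] (0 : ℝ)))
      (fun μ : RandomBoxes.testMeasures γ₁ γ₂ ↦ RandomBoxes.limitField γ₁ γ₂ P' N' μ)
      P P' := by
  obtain ⟨hi₁, hi₂⟩ := RandomBoxes.integrableOn_of_isProbabilityMeasure hf₁m hf₂m hf₁nonneg
    hf₂nonneg hF
  have hσ : ∀ ρ : Set.Ioi (0 : ℝ),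
      SigmaFinite (RandomBoxes.scaledIntensity f₁ f₂ (lam ρ) ρ) := fun ρ ↦
    RandomBoxes.sigmaFinite_scaledIntensity hf₁m hf₂m hf₁nonneg ρ.2 _
  have hint : ∀ (ρ : Set.Ioi (0 : ℝ)) (μ : SignedMeasure (ℝ × ℝ)),
      Integrable (RandomBoxes.boxMass μ) (RandomBoxes.scaledIntensity f₁ f₂ (lam ρ) ρ) :=
    fun ρ μ ↦ RandomBoxes.integrable_boxMass_scaledIntensity hγ₁.1 hγ₂.1 hf₁m hf₂m hf₁nonneg
      hf₂nonneg hi₁ hi₂ hf₁ hf₂ _ _ μ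
  have hL : ∀ μ ∈ RandomBoxes.testMeasures γ₁ γ₂,
      MemLp (RandomBoxes.boxMass μ) 2 (RandomBoxes.limitIntensity γ₁ γ₂) := fun μ hμ ↦
    RandomBoxes.memLp_boxMass_limitIntensity hγ₁.1 hγ₂.1 hμ
  have hcomp : ∀ μ ∈ RandomBoxes.testMeasures γ₁ γ₂,
      RandomBoxes.IsCompensatedIntegral P' N' (RandomBoxes.limitIntensity γ₁ γ₂)
        (RandomBoxes.boxMass μ) (RandomBoxes.limitField γ₁ γ₂ P' N' μ) := fun μ hμ ↦
    RandomBoxes.isCompensatedIntegral_compensatedIntegral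
      (RandomBoxes.exists_isCompensatedIntegral hN' (RandomBoxes.measurable_boxMass μ) (hL μ hμ))
  have hclosed : ∀ μ ∈ RandomBoxes.testMeasures γ₁ γ₂, ∀ ν ∈ RandomBoxes.testMeasures γ₁ γ₂,
      ∀ a b : ℝ, a • μ + b • ν ∈ RandomBoxes.testMeasures γ₁ γ₂ := fun μ hμ ν hν ↦
    RandomBoxes.linearCombination_mem_testMeasures hγ₁.1 hγ₂.1 hμ hν
  have hlin : ∀ μ ∈ RandomBoxes.testMeasures γ₁ γ₂, ∀ ν ∈ RandomBoxes.testMeasures γ₁ γ₂,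
      ∀ a b : ℝ, RandomBoxes.limitField γ₁ γ₂ P' N' (a • μ + b • ν) =ᵐ[P']
        a • RandomBoxes.limitField γ₁ γ₂ P' N' μ +
          b • RandomBoxes.limitField γ₁ γ₂ P' N' ν := by
    intro μ hμ ν hν a b
    have h := hcomp _ (hclosed μ hμ ν hν a b)
    rw [RandomBoxes.boxMass_linearCombination] at h
    exact RandomBoxes.IsCompensatedIntegral.linearCombination hN'
      (RandomBoxes.measurable_boxMass μ) (hL μ hμ) (RandomBoxes.measurable_boxMass ν) (hL ν hν)
      (hcomp μ hμ) (hcomp ν hν) h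
  refine ⟨fun ρ μ ↦ ⟨(hN ρ).ae_integrable (RandomBoxes.measurable_boxMass μ) (hint ρ μ),
    (hN ρ).integrable_integral (RandomBoxes.measurable_boxMass μ) (hint ρ μ)⟩, hcomp, hlin,
    fun m t ↦ ?_⟩
  have h0 := RandomBoxes.zero_mem_testMeasures hγ₁.2 hγ₂.2
  refine RandomBoxes.tendstoInDistribution_of_tendsto_integral_cexp (fun ρ ↦ ?_) ?_ fun c ↦ ?_
  · refine aemeasurable_pi_lambda _ fun k ↦ ?_
    simp only [RandomBoxes.centredField_eq_centredIntegral (hN ρ) (hint ρ _)]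
    exact ((hN ρ).integrable_centredIntegral (RandomBoxes.measurable_boxMass _)
      (hint ρ _)).aestronglyMeasurable.aemeasurable
  · exact aemeasurable_pi_lambda _ fun k ↦ (hcomp _ (t k).2).measurable.aemeasurable
  -- By linearity the joint characteristic function at c is the characteristic function at frequency
  -- 1 of the field at the single test measure σ.
  · set σ : SignedMeasure (ℝ × ℝ) := ∑ k, c k • (t k : SignedMeasure (ℝ × ℝ)) with hσdef
    have hsum := RandomBoxes.sum_smul_mem_and_ae_eq h0 hclosed hlin Finset.univ c
      fun k ↦ (t k).2
    have hlimit : ∫ ω, Complex.exp ((∑ k, c k *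
        RandomBoxes.limitField γ₁ γ₂ P' N' (t k) ω : ℝ) * Complex.I) ∂P' =
        Complex.exp (∫ p, RandomBoxes.jumpExponent (RandomBoxes.boxMass σ p)
          ∂(RandomBoxes.limitIntensity γ₁ γ₂)) := by
      rw [← RandomBoxes.IsCompensatedIntegral.integral_cexp hN'
        (RandomBoxes.measurable_boxMass σ) (hL σ hsum.1) (hcomp σ hsum.1)]
      refine integral_congr_ae ?_
      filter_upwards [hsum.2] with ω hω
      rw [hσdef, hω]
    have hscaled : ∀ ρ : Set.Ioi (0 : ℝ), ∫ ω, Complex.exp ((∑ k, c k *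
        RandomBoxes.centredField (P ρ) (N ρ) (t k) ω : ℝ) * Complex.I) ∂(P ρ) =
        Complex.exp (∫ p, RandomBoxes.jumpExponent (RandomBoxes.boxMass σ p)
          ∂(RandomBoxes.scaledIntensity f₁ f₂ (lam ρ) ρ)) := by
      intro ρ
      -- Before the limit box masses are integrable for every signed measure, so linearity holds on
      -- the whole space.
      have hs := (RandomBoxes.sum_smul_mem_and_ae_eq (P := P ρ)
        (J := RandomBoxes.centredField (P ρ) (N ρ)) (S := Set.univ) trivial
        (fun _ _ _ _ _ _ ↦ trivial) (fun μ _ ν _ a b ↦ by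
          rw [RandomBoxes.centredField_eq_centredIntegral (hN ρ) (hint ρ _),
            RandomBoxes.centredField_eq_centredIntegral (hN ρ) (hint ρ _),
            RandomBoxes.centredField_eq_centredIntegral (hN ρ) (hint ρ _),
            RandomBoxes.boxMass_linearCombination]
          exact (hN ρ).centredIntegral_linearCombination (RandomBoxes.measurable_boxMass μ)
            (hint ρ μ) (RandomBoxes.measurable_boxMass ν) (hint ρ ν) a b)
        Finset.univ c (μ := fun k ↦ (t k : SignedMeasure (ℝ × ℝ))) fun _ ↦ trivial).2
      rw [← (hN ρ).integral_cexp_centredIntegral (RandomBoxes.measurable_boxMass σ) (hint ρ σ),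
        ← RandomBoxes.centredField_eq_centredIntegral (hN ρ) (hint ρ σ)]
      refine integral_congr_ae ?_
      filter_upwards [hs] with ω hω
      rw [hσdef, hω]
    rw [hlimit]
    simp_rw [hscaled]
    refine (Complex.continuous_exp.tendsto _).comp ?_
    exact (RandomBoxes.tendsto_integral_jumpExponent hγ₁.1 hγ₂.1 hf₁m hf₂m hf₁nonneg hf₂nonneg
      hi₁ hi₂ hf₁ hf₂ hlam_pos hlam_scale hsum.1).comp tendsto_comap
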